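/- For $T=\begin{bmatrix}a&b\\c&d\end{bmatrix}\in PSL(2,\mathbb R)$ put $\mathrm{tr}(T)=|a+d|$, and for $u\ge 0$ put $\mathrm{tr}(u)=2\cosh\frac u2$. For $u,v\ge 0$ let $Y(u,v,0)$ be the Y-piece with boundary geodesics of lengths $u$, $v$, $0$, i.e. the hyperbolic surface of signature $(0,3)$ obtained by gluing two copies of the right-angled geodesic hexagon with alternate sides of lengths $\frac u2,\frac v2,0$ along the three remaining sides; a length $0$ means a cusp (an ideal vertex of the hexagon). For $0<\theta\le\frac\pi2$ let $Y_\theta(v,0)$ be the degenerated Y-piece in which the boundary geodesic $u$ is replaced by a cone point of angle $2\theta$ (the side of length $\frac u2$ of the hexagon is replaced by a vertex of angle $\theta$), and put $\mathrm{tr}(u)=2\cos\theta$ in this case. A quotient $G\backslash\mathbb H$ contains a (degenerated) Y-piece if the Y-piece admits a locally isometric embedding into it. Let $\Gamma\subset PSL(2,\mathbb R)$ be a Fuchsian group (a discrete subgroup) containing $T=\begin{bmatrix}1&1\\0&1\end{bmatrix}$. Then for every $T_u=\begin{bmatrix}a_1&b_1\\c&d\end{bmatrix}\in\Gamma$ with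 $c\ne0$ there are $k\in\mathbb Z$ and $v\ge 0$ such that $T_v:=T^kT_u=\begin{bmatrix}a_2&b_2\\c&d\end{bmatrix}\in\Gamma$ satisfies $|a_2+d|=\mathrm{tr}(v)$ and $(a_1+d)(a_2+d)\le 0$, and such that the following holds. 1. If $|a_1+d|\ge 2$, then $\langle T_u,T_v\rangle\backslash\mathbb H$ contains $Y(u,v,0)$, where $u\ge0$ and $\mathrm{tr}(u)=|a_1+d|$. 2. If $|a_1+d|<2$, let $0<\theta\le\frac\pi2$ be such that $2\cos\theta=|a_1+d|$. If $\theta=\frac\pi n$ for an integer $n\ge2$, then $\langle T_u,T_v\rangle\backslash\mathbb H$ contains the degenerated Y-piece $Y_\theta(v,0)$ (so $\mathrm{tr}(u)=|a_1+d|$), with the cone point lying at the image of the fixed point of $T_u$. For the other values of $\theta$ there is a continuous map $Y_\theta(v,0)\to\langle T_u,T_v\rangle\backslash\mathbb H$ which takes the cone point to the image of the fixed point of $T_u$ and is locally isometric away from the cone point. -/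

import Mathlib

open scoped MatrixGroups UpperHalfPlane NNReal Topology

/-- The class in `PSL(2, ℝ)` of a real matrix of determinant one. -/
def toPSL (A : SL(2, ℝ)) : PSL(2, ℝ) := QuotientGroup.mk A

/-- A Fuchsian group: a discrete subgroup of `PSL(2, ℝ)`. -/
def IsFuchsian (Γ : Subgroup PSL(2, ℝ)) : Prop := DiscreteTopology Γ

/-- The parabolic matrix `[[1, 1], [0, 1]]`. -/
def unitParabolic : SL(2, ℝ) := ⟨!![1, 1; 0, 1], by simp [Matrix.det_fin_two]⟩

/-- The full preimage in `SL(2, ℝ)` of a subgroup of `PSL(2, ℝ)`. Since the center of `SL(2, ℝ)`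
acts trivially on `ℍ`, the orbits of `G` on `ℍ` are those of this group. -/
def liftSL (G : Subgroup PSL(2, ℝ)) : Subgroup SL(2, ℝ) :=
  G.comap (QuotientGroup.mk' (Subgroup.center SL(2, ℝ)))

/-- The quotient `G \ ℍ`, with the quotient topology. -/
noncomputable abbrev HypQuotient (G : Subgroup PSL(2, ℝ)) : Type :=
  Quotient (MulAction.orbitRel (liftSL G) ℍ)

/-- The projection `ℍ → G \ ℍ`. -/
noncomputable def HypQuotient.proj (G : Subgroup PSL(2, ℝ)) (z : ℍ) : HypQuotient G :=
  Quotient.mk (MulAction.orbitRel (liftSL G) ℍ) z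

/-- The hyperbolic distance on `G \ ℍ`: the distance of two orbits. -/
noncomputable def HypQuotient.hdist {G : Subgroup PSL(2, ℝ)} (p q : HypQuotient G) : ℝ :=
  sInf {r : ℝ | ∃ z w : ℍ, proj G z = p ∧ proj G w = q ∧ r = dist z w}

/-- The convex geodesic polygon in `ℍ` bounded by the vertical lines `Re z = α` and `Re z = -β`,
by the unit circle, and by the circles with centers `α` and `-β` orthogonal to the unit circle
(the last two conditions say nothing when `α ≤ 1`, respectively `β ≤ 1`).

The sides on `Re z = α` and `Re z = -β` meet at the ideal point `∞`. If `α = cosh (u / 2)`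
then the sides on `Re z = α` and on the unit circle are at distance `u / 2`, and the side on the
circle with center `α` is their common perpendicular (for `u = 0` they meet at the ideal point
`1`); similarly for `β = cosh (v / 2)`. So for `α = cosh (u / 2)` and `β = cosh (v / 2)` this
is the right-angled geodesic hexagon with alternate sides of lengths `u / 2`, `v / 2`, `0`, where
a side of length `0` is an ideal vertex. If `α = cos θ` with `0 < θ ≤ π / 2`, the side of length
`u / 2` is replaced by a vertex in `ℍ` with angle `θ`. -/
def halfPiece (α β : ℝ≥0) : Set ℍ :=
  {z | -(β : ℝ) ≤ z.re ∧ z.re ≤ α ∧ 1 ≤ z.re ^ 2 + z.im ^ 2 ∧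
    (α : ℝ) ^ 2 - 1 ≤ (z.re - α) ^ 2 + z.im ^ 2 ∧ (β : ℝ) ^ 2 - 1 ≤ (z.re + β) ^ 2 + z.im ^ 2}

/-- The three sides of `halfPiece α β` other than the ones of lengths `u / 2` and `v / 2`. -/
def halfPieceSeams (α β : ℝ≥0) : Set (halfPiece α β) :=
  {p | p.1.re = α ∨ p.1.re = -(β : ℝ) ∨ p.1.re ^ 2 + p.1.im ^ 2 = 1}

instance halfPieceSeams_nonempty (α β : ℝ≥0) : Nonempty (halfPieceSeams α β) := by
  have hα := α.coe_nonneg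
  have hβ := β.coe_nonneg
  refine ⟨⟨⟨⟨⟨α, 1 + α + β⟩, by positivity⟩, ?_⟩, Or.inl rfl⟩⟩
  refine ⟨?_, le_rfl, ?_, ?_, ?_⟩ <;>
    simp only [UpperHalfPlane.re, UpperHalfPlane.im] <;> nlinarith [mul_nonneg hα hβ]

/-- The surface obtained from two copies of `halfPiece α β` by gluing them along the three seams,
with the metric of the gluing.

For `u, v ≥ 0`, `α = cosh (u / 2)` and `β = cosh (v / 2)` it is the Y-piece `Y(u, v, 0)`: the
hyperbolic surface of signature `(0, 3)` whose boundary components are closed geodesics of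
lengths `u` and `v` and a cusp (a boundary geodesic of length `0` being a cusp as well).
For `α = cos θ` it is the degenerated Y-piece in which the boundary geodesic `u` is replaced by
a cone point of angle `2 * θ`. -/
abbrev GluedPiece (α β : ℝ≥0) : Type :=
  Metric.GlueSpace (Φ := ((↑) : halfPieceSeams α β → halfPiece α β))
    (Ψ := ((↑) : halfPieceSeams α β → halfPiece α β)) isometry_subtype_coe isometry_subtype_coe

/-- The Y-piece `Y(u, v, 0)`. -/
abbrev YPiece (u v : ℝ) : Type :=
  GluedPiece (Real.cosh (u / 2)).toNNReal (Real.cosh (v / 2)).toNNReal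

/-- The degenerated Y-piece with a cone point of angle `2 * θ`, a boundary geodesic of length `v`
and a cusp. -/
abbrev ConeYPiece (θ v : ℝ) : Type :=
  GluedPiece (Real.cos θ).toNNReal (Real.cosh (v / 2)).toNNReal

/-- The cone point of a degenerated Y-piece: the point of the glued surface given by the vertex
of `halfPiece α β` on the line `Re z = α` and on the unit circle. -/
def IsConePoint {α β : ℝ≥0} (y : GluedPiece α β) : Prop :=
  ∃ p : halfPiece α β, p.1.re = α ∧ p.1.re ^ 2 + p.1.im ^ 2 = 1 ∧
    y = Metric.toGlueL isometry_subtype_coe isometry_subtype_coe p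

/-- `f` preserves distances on a neighbourhood of `y`. -/
def IsLocallyIsometricAt {Y : Type} [MetricSpace Y] {G : Subgroup PSL(2, ℝ)}
    (f : Y → HypQuotient G) (y : Y) : Prop :=
  ∃ U ∈ 𝓝 y, ∀ a ∈ U, ∀ b ∈ U, HypQuotient.hdist (f a) (f b) = dist a b

/-- `G \ ℍ` contains the Y-piece `Y(u, v, 0)`: there is a locally isometric embedding. -/
def ContainsYPiece (G : Subgroup PSL(2, ℝ)) (u v : ℝ) : Prop :=
  ∃ f : YPiece u v → HypQuotient G,
    Topology.IsEmbedding f ∧ ∀ y, IsLocallyIsometricAt f y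

/-- `G \ ℍ` contains the degenerated Y-piece with cone angle `2 * θ`, boundary length `v` and a
cusp, the cone point lying at the elliptic fixed point of `A`. If `θ = π / n`, this is a locally
isometric embedding. If `θ` is not of this form, then `2 * θ` is not the cone angle of a point of
a quotient of `ℍ` by a Fuchsian group, and the containment is a continuous map which is locally
isometric away from the cone point. -/
def ContainsConeYPiece (G : Subgroup PSL(2, ℝ)) (A : SL(2, ℝ)) (θ v : ℝ) : Prop :=
  ∃ f : ConeYPiece θ v → HypQuotient G,
    Continuous f ∧
    (∀ y, IsConePoint y → ∃ z : ℍ, A • z = z ∧ f y = HypQuotient.proj G z) ∧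
    (∀ y, ¬ IsConePoint y → IsLocallyIsometricAt f y) ∧
    ((∃ n : ℕ, 2 ≤ n ∧ θ = Real.pi / n) →
      Topology.IsEmbedding f ∧ ∀ y, IsLocallyIsometricAt f y)

/-! A matrix with lower row `(c, d)` sends `z` to `z'` with `c z' + d = (a + d) - 1 / (c z + d)`. In
the coordinate `w = ±(c z + d)`, conjugated if necessary to stay in `ℍ`, `Tu` is therefore `w ↦ 2α -
1 / w` with `2α = |a₁ + d|`: the reflection in the unit circle followed by the reflection in `Re w =
α`. Multiplying by a power of `unitParabolic` on the left only moves the line, so for suitable `k`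
the second generator is the reflection in the unit circle followed by the one in `Re w = -β`, with
`β` as large as desired (`exists_isPieceChart`). The group generated is the group of even words in
three reflections. In the quotient the three reflections induce one and the same involution, so the
half piece and its mirror image fit together to a map from the glued piece (`exists_pieceMap`). This
map never increases distances (`hdist_pieceMap_le`).

If `α ≥ 1`, the mirrors are pairwise disjoint; if `α = cos (π / n)`, two of them generate a finite
dihedral group and the third is disjoint from their sector. In both cases the region between the
mirrors is a chamber: folding a geodesic back at the mirrors it crosses gives a path in the chamber
that is no longer than the geodesic (`IsChamber.insert`, `isChamber_dihedral`). A path through a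
wall can be moved to a seam of the truncated region (`exists_seam`), so the map from the glued piece
is a global isometry onto its image (`dist_le_hdist_pieceMap`).

For the other angles there is no chamber. By discreteness the rotation `Tu` has finite order
(`IsFuchsian.exists_pow_smul_eq`). If `β` is large compared with the finitely many rotations, a
ping-pong between these rotations and the translation by `2(α + β)` shows that every point of the
half piece other than the vertex has a positive injectivity radius (`exists_injectivity_radius`).
This makes the map locally isometric away from the cone point (`isLocallyIsometricAt`). -/

namespace UpperHalfPlane

/-! ### Geodesic segments in the coordinates `Re z` and `|z|²` -/

/-- The square of the absolute value of a point of the upper half plane. -/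
noncomputable def absSq (z : ℍ) : ℝ := z.re ^ 2 + z.im ^ 2

lemma absSq_pos (z : ℍ) : 0 < z.absSq := by
  have := z.im_pos
  unfold absSq
  positivity

/-- The numerator is affine in `(Re, |·|²)` of each point separately; in these coordinates geodesics
are straight, as in the Klein model. -/
lemma cosh_dist_eq_absSq (z w : ℍ) :
    Real.cosh (dist z w) = (z.absSq + w.absSq - 2 * z.re * w.re) / (2 * z.im * w.im) := by
  rw [cosh_dist']
  unfold absSq
  ring

lemma dist_le_dist_iff_cosh {a b c d : ℍ} :
    dist a b ≤ dist c d ↔ Real.cosh (dist a b) ≤ Real.cosh (dist c d) := by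
  rw [Real.cosh_le_cosh, abs_of_nonneg dist_nonneg, abs_of_nonneg dist_nonneg]

lemma dist_eq_dist_of_cosh {a b c d : ℍ}
    (h : Real.cosh (dist a b) = Real.cosh (dist c d)) : dist a b = dist c d :=
  le_antisymm (dist_le_dist_iff_cosh.2 h.le) (dist_le_dist_iff_cosh.2 h.ge)

/-- A point whose coordinates `Re` and `|·|²` divide those of `x` and `z` in the same ratio lies
on the geodesic segment from `x` to `z`. -/
lemma dist_add_dist_le_of_mem_segment {x z s : ℍ} {t : ℝ} (h0 : 0 ≤ t) (h1 : t ≤ 1)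
    (hre : s.re = (1 - t) * x.re + t * z.re) (hab : s.absSq = (1 - t) * x.absSq + t * z.absSq) :
    dist x s + dist s z ≤ dist x z := by
  have hX := x.im_pos
  have hZ := z.im_pos
  have hY := s.im_pos
  set C := Real.cosh (dist x z) with hC
  set S := Real.sinh (dist x z) with hS
  have hCS : C ^ 2 - S ^ 2 = 1 := Real.cosh_sq_sub_sinh_sq _
  have hS0 : 0 ≤ S := Real.sinh_nonneg_iff.2 dist_nonneg
  have hC1 : C * (2 * x.im * z.im) = x.absSq + z.absSq - 2 * x.re * z.re := by
    rw [hC, cosh_dist_eq_absSq]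
    field_simp
  -- In the hyperboloid model the vector of `s` is `l` times that of `x` plus `m` times that of `z`.
  -- So `hq` says that `s` lies on the hyperboloid, and `c1`, `c2` are its products with `x` and
  -- `z`.
  obtain ⟨l, hl⟩ : ∃ l, l = (1 - t) * x.im / s.im := ⟨_, rfl⟩
  obtain ⟨m, hm⟩ : ∃ m, m = t * z.im / s.im := ⟨_, rfl⟩
  have hl0 : 0 ≤ l := by rw [hl]; have : 0 ≤ 1 - t := by linarith
                         positivity
  have hm0 : 0 ≤ m := by rw [hm]; positivity
  have hls : l * s.im = (1 - t) * x.im := by rw [hl]; field_simp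
  have hms : m * s.im = t * z.im := by rw [hm]; field_simp
  have hxa : x.absSq = x.re ^ 2 + x.im ^ 2 := rfl
  have hza : z.absSq = z.re ^ 2 + z.im ^ 2 := rfl
  have hsa : s.absSq = s.re ^ 2 + s.im ^ 2 := rfl
  have hq : l ^ 2 + m ^ 2 + 2 * l * m * C = 1 := by
    have e : (l ^ 2 + m ^ 2 + 2 * l * m * C) * s.im ^ 2 = 1 * s.im ^ 2 := by
      have : (l ^ 2 + m ^ 2 + 2 * l * m * C) * s.im ^ 2
          = (l * s.im) ^ 2 + (m * s.im) ^ 2 + 2 * (l * s.im) * (m * s.im) * C := by ring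
      rw [this, hls, hms]
      have e2 : s.im ^ 2 = s.absSq - s.re ^ 2 := by rw [hsa]; ring
      rw [one_mul, e2, hab, hre]
      linear_combination t * (1 - t) * hC1 + (-(1-t)^2) * hxa - t^2 * hza
    exact mul_right_cancel₀ (by positivity) e
  have c1 : Real.cosh (dist x s) = l + m * C := by
    rw [cosh_dist_eq_absSq, div_eq_iff (by positivity)]
    have : (l + m * C) * (2 * x.im * s.im) = 2 * x.im * (l * s.im) + (m * s.im) * C * 2 * x.im := by
      ring
    rw [this, hls, hms, hab, hre]
    linear_combination (-t) * hC1 + (2 - 2 * t) * hxa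
  have c2 : Real.cosh (dist s z) = l * C + m := by
    rw [cosh_dist_eq_absSq, div_eq_iff (by positivity)]
    have : (l * C + m) * (2 * s.im * z.im) = (l * s.im) * C * 2 * z.im + 2 * z.im * (m * s.im) := by
      ring
    rw [this, hls, hms, hab, hre]
    linear_combination (-(1 - t)) * hC1 + (2 * t) * hza
  have s1 : Real.sinh (dist x s) = m * S := by
    have h := Real.cosh_sq_sub_sinh_sq (dist x s)
    rw [c1] at h
    have h2 : Real.sinh (dist x s) ^ 2 = (m * S) ^ 2 := by
      linear_combination (-1 : ℝ) * h + hq + m ^ 2 * hCS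
    exact (sq_eq_sq₀ (Real.sinh_nonneg_iff.2 dist_nonneg) (by positivity)).1 h2
  have s2 : Real.sinh (dist s z) = l * S := by
    have h := Real.cosh_sq_sub_sinh_sq (dist s z)
    rw [c2] at h
    have h2 : Real.sinh (dist s z) ^ 2 = (l * S) ^ 2 := by
      linear_combination (-1 : ℝ) * h + hq + l ^ 2 * hCS
    exact (sq_eq_sq₀ (Real.sinh_nonneg_iff.2 dist_nonneg) (by positivity)).1 h2
  have hsum : Real.cosh (dist x s + dist s z) = C := by
    rw [Real.cosh_add, c1, c2, s1, s2]
    linear_combination C * hq - l * m * hCS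
  have := (Real.cosh_le_cosh (x := dist x s + dist s z) (y := dist x z)).1 hsum.le
  rwa [abs_of_nonneg (by positivity), abs_of_nonneg dist_nonneg] at this

/-- The image of `ℍ` under `(Re, |·|²)` is the region above a parabola, which is convex. -/
lemma exists_mem_segment (x z : ℍ) {t : ℝ} (h0 : 0 ≤ t) (h1 : t ≤ 1) :
    ∃ s : ℍ, s.re = (1 - t) * x.re + t * z.re ∧ s.absSq = (1 - t) * x.absSq + t * z.absSq := by
  have hX := x.im_pos
  have hZ := z.im_pos
  have h1' : 0 ≤ 1 - t := by linarith
  have hpos : 0 < ((1 - t) * x.absSq + t * z.absSq) - ((1 - t) * x.re + t * z.re) ^ 2 := by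
    have e : ((1 - t) * x.absSq + t * z.absSq) - ((1 - t) * x.re + t * z.re) ^ 2
        = (1 - t) * x.im ^ 2 + t * z.im ^ 2 + (1 - t) * t * (x.re - z.re) ^ 2 := by
      unfold absSq; ring
    rw [e]
    rcases h0.eq_or_lt with h | h
    · subst h; simp; positivity
    · positivity
  refine ⟨⟨⟨(1 - t) * x.re + t * z.re, √(((1 - t) * x.absSq + t * z.absSq) -
    ((1 - t) * x.re + t * z.re) ^ 2)⟩, Real.sqrt_pos.2 hpos⟩, rfl, ?_⟩
  unfold absSq at hpos ⊢
  simp only [mk_re, mk_im]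
  rw [Real.sq_sqrt hpos.le]
  ring

/-- A function of the form `a + b Re z + c |z|²`. Its zero set is a geodesic. -/
def IsGeodesicEq (g : ℍ → ℝ) : Prop := ∃ a b c : ℝ, ∀ z, g z = a + b * z.re + c * z.absSq

lemma IsGeodesicEq.of_segment {g : ℍ → ℝ} (hg : IsGeodesicEq g) {x z s : ℍ} {t : ℝ}
    (hre : s.re = (1 - t) * x.re + t * z.re) (hab : s.absSq = (1 - t) * x.absSq + t * z.absSq) :
    g s = (1 - t) * g x + t * g z := by
  obtain ⟨a, b, c, h⟩ := hg
  rw [h, h, h, hre, hab]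
  ring

lemma IsGeodesicEq.neg {g : ℍ → ℝ} (hg : IsGeodesicEq g) : IsGeodesicEq (fun z => -g z) := by
  obtain ⟨a, b, c, h⟩ := hg
  exact ⟨-a, -b, -c, fun z => by simp only [h]; ring⟩

/-- Along the segment `g` is affine in the parameter, so it vanishes somewhere. The last clause is
the convexity of half planes; it serves to locate the crossing point within a wall. -/
lemma IsGeodesicEq.exists_crossing {g : ℍ → ℝ} (hg : IsGeodesicEq g) {x z : ℍ} (hx : 0 ≤ g x)
    (hz : g z ≤ 0) : ∃ s, g s = 0 ∧ dist x s + dist s z ≤ dist x z ∧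
      ∀ g', IsGeodesicEq g' → 0 ≤ g' x → 0 ≤ g' z → 0 ≤ g' s := by
  obtain ⟨t, h0, h1, ht⟩ : ∃ t : ℝ, 0 ≤ t ∧ t ≤ 1 ∧ (1 - t) * g x + t * g z = 0 := by
    by_cases h : g x - g z = 0
    · exact ⟨0, le_rfl, zero_le_one, by linarith⟩
    · have hp : 0 < g x - g z := lt_of_le_of_ne (by linarith) (Ne.symm h)
      refine ⟨g x / (g x - g z), by positivity, by rw [div_le_one hp]; linarith, by
        field_simp; ring⟩
  obtain ⟨s, hre, hab⟩ := exists_mem_segment x z h0 h1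
  refine ⟨s, by rw [hg.of_segment hre hab, ht], dist_add_dist_le_of_mem_segment h0 h1 hre hab,
    fun g' hg' hx' hz' => ?_⟩
  rw [hg'.of_segment hre hab]
  have : 0 ≤ 1 - t := by linarith
  positivity

/-! ### Reflections in geodesics -/

/-- `r` is the reflection in the geodesic `g = 0`. -/
structure IsMirror (r : ℍ → ℍ) (g : ℍ → ℝ) : Prop where
  geod : IsGeodesicEq g
  isom : ∀ x y, dist (r x) (r y) = dist x y
  invol : ∀ x, r (r x) = x
  swap : ∀ x, 0 ≤ g x → g (r x) ≤ 0
  swap' : ∀ x, g x ≤ 0 → 0 ≤ g (r x)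
  fix : ∀ x, g x = 0 → r x = x

lemma IsMirror.neg {r : ℍ → ℍ} {g : ℍ → ℝ} (h : IsMirror r g) : IsMirror r (fun z => -g z) where
  geod := h.geod.neg
  isom := h.isom
  invol := h.invol
  swap x hx := by have := h.swap' x (by linarith); linarith
  swap' x hx := by have := h.swap x (by linarith); linarith
  fix x hx := h.fix x (by linarith)

lemma IsMirror.dist_comm {r : ℍ → ℍ} {g : ℍ → ℝ} (h : IsMirror r g) (x y : ℍ) :
    dist (r x) y = dist x (r y) := by
  rw [← h.isom x (r y), h.invol]

/-- The geodesic from `x` to `r y` crosses the mirror at `s`; reflecting its second part back gives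
a path from `x` by way of `s` to `y` of the same length. -/
lemma IsMirror.exists_wall {r : ℍ → ℍ} {g : ℍ → ℝ} (h : IsMirror r g) {x y : ℍ} (hx : 0 ≤ g x)
    (hy : 0 ≤ g y) : ∃ s, g s = 0 ∧ dist x s + dist s y ≤ dist x (r y) ∧
      ∀ g', IsGeodesicEq g' → 0 ≤ g' x → 0 ≤ g' (r y) → 0 ≤ g' s := by
  obtain ⟨s, hs, hd, hg'⟩ := h.geod.exists_crossing hx (h.swap y hy)
  refine ⟨s, hs, ?_, hg'⟩
  rwa [← h.dist_comm, h.fix s hs] at hd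

/-- The reflection in the vertical line `Re z = m`. -/
noncomputable def reflLine (m : ℝ) (z : ℍ) : ℍ := ⟨⟨2 * m - z.re, z.im⟩, z.im_pos⟩

@[simp] lemma reflLine_re (m : ℝ) (z : ℍ) : (reflLine m z).re = 2 * m - z.re := rfl
@[simp] lemma reflLine_im (m : ℝ) (z : ℍ) : (reflLine m z).im = z.im := rfl

lemma isMirror_reflLine (m : ℝ) : IsMirror (reflLine m) (fun z => m - z.re) where
  geod := ⟨m, -1, 0, fun z => by ring⟩
  isom x y := by
    apply dist_eq_dist_of_cosh
    rw [cosh_dist', cosh_dist']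
    simp only [reflLine_re, reflLine_im]
    ring
  invol x := ext_re_im (by simp) (by simp)
  swap x hx := by simp only [reflLine_re]; linarith
  swap' x hx := by simp only [reflLine_re]; linarith
  fix x hx := ext_re_im (by simp only [reflLine_re]; linarith) rfl

/-- The reflection in the unit circle. -/
noncomputable def reflUnit (z : ℍ) : ℍ :=
  ⟨⟨z.re / z.absSq, z.im / z.absSq⟩, div_pos z.im_pos z.absSq_pos⟩

@[simp] lemma reflUnit_re (z : ℍ) : (reflUnit z).re = z.re / z.absSq := rfl
@[simp] lemma reflUnit_im (z : ℍ) : (reflUnit z).im = z.im / z.absSq := rfl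

lemma reflUnit_absSq (z : ℍ) : (reflUnit z).absSq = 1 / z.absSq := by
  have h := z.absSq_pos
  have e : (reflUnit z).absSq = (z.re ^ 2 + z.im ^ 2) / z.absSq ^ 2 := by
    rw [absSq, reflUnit_re, reflUnit_im]; field_simp
  rw [e, ← absSq]
  field_simp

lemma isMirror_reflUnit : IsMirror reflUnit (fun z => z.absSq - 1) where
  geod := ⟨-1, 0, 1, fun z => by ring⟩
  isom x y := by
    have := x.absSq_pos
    have := y.absSq_pos
    have := x.im_pos
    have := y.im_pos
    apply dist_eq_dist_of_cosh
    rw [cosh_dist_eq_absSq, cosh_dist_eq_absSq, reflUnit_absSq, reflUnit_absSq]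
    simp only [reflUnit_re, reflUnit_im]
    field_simp
    ring
  invol x := by
    have := x.absSq_pos
    apply ext_re_im
    · rw [reflUnit_re, reflUnit_absSq, reflUnit_re]; field_simp
    · rw [reflUnit_im, reflUnit_absSq, reflUnit_im]; field_simp
  swap x hx := by
    have h := x.absSq_pos
    rw [reflUnit_absSq, sub_nonpos, div_le_one h]
    linarith
  swap' x hx := by
    have h := x.absSq_pos
    rw [reflUnit_absSq, sub_nonneg, one_le_div h]
    linarith
  fix x hx := by
    have h : x.absSq = 1 := by linarith
    apply ext_re_im <;> simp [h]

/-! ### Chambers of reflection groups and the amalgamation step -/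

/-- `Q` is a fundamental chamber, with walls in `B`, for the orbits of the reflections in `R`:
each `y ∈ Q` has an even and an odd orbit, the points of the even orbit are at least as far from
`x ∈ Q` as `y`, and the geodesics from `x ∈ Q` to the points of the odd orbit are at least as long
as a path from `x` to `y` that meets `B`. -/
def IsChamber (R : Set (ℍ → ℍ)) (Q B : Set ℍ) : Prop :=
  ∀ y ∈ Q, ∃ O : Bool → Set ℍ, y ∈ O false ∧ (∀ r ∈ R, ∀ b, ∀ z ∈ O b, r z ∈ O (!b)) ∧
    (∀ x ∈ Q, ∀ z ∈ O false, dist x y ≤ dist x z) ∧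
    ∀ x ∈ Q, ∀ z ∈ O true, ∃ s ∈ B, dist x s + dist s y ≤ dist x z

lemma isChamber_univ : IsChamber ∅ Set.univ ∅ := fun y _ =>
  ⟨fun b => if b then ∅ else {y}, by simp, by simp, by simp, by simp⟩

/-- The orbit in an amalgam: words in the old orbits and a new reflection. -/
inductive AmalgamOrbit (O : ℍ → Bool → Set ℍ) (r : ℍ → ℍ) (g : ℍ → ℝ) (y : ℍ) : Bool → ℍ → Prop
  | base {b z} : z ∈ O y b → AmalgamOrbit O r g y b z
  | step {b b' w z} : AmalgamOrbit O r g y b w → 0 ≤ g w → z ∈ O (r w) b' →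
      AmalgamOrbit O r g y (!(b.xor b')) z

/-- Adding to a system of reflections one whose mirror lies inside the chamber. -/
lemma IsChamber.insert {R : Set (ℍ → ℍ)} {Q B : Set ℍ} (h : IsChamber R Q B) {r : ℍ → ℍ}
    {g : ℍ → ℝ} (hr : IsMirror r g) (hQ : ∀ z, g z ≤ 0 → z ∈ Q) (hB : ∀ z ∈ B, 0 < g z) :
    IsChamber (insert r R) (Q ∩ {z | 0 ≤ g z}) (B ∪ {z | g z = 0}) := by
  classical
  choose! O hO using h
  intro y ⟨hyQ, hyg⟩
  have key : ∀ b z, AmalgamOrbit O r g y b z → 0 ≤ g y → y ∈ Q →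
      ∀ x ∈ Q, 0 ≤ g x → dist x y ≤ dist x z ∧
        (b = true → ∃ s, (s ∈ B ∨ g s = 0) ∧ dist x s + dist s y ≤ dist x z) := by
    intro b z hz hgy hyQ
    induction hz with
    | @base b z hz =>
      intro x hx hgx
      obtain ⟨-, -, h3, h4⟩ := hO y hyQ
      cases b with
      | false => exact ⟨h3 x hx z hz, by simp⟩
      | true =>
        obtain ⟨s, hs, hd⟩ := h4 x hx z hz
        exact ⟨(dist_triangle _ _ _).trans hd, fun _ => ⟨s, Or.inl hs, hd⟩⟩
    | @step b b' w z hw hgw hz ih =>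
      intro x hx hgx
      have hrw : r w ∈ Q := hQ _ (hr.swap w hgw)
      obtain ⟨-, -, h3, h4⟩ := hO _ hrw
      have hd : dist x (r w) ≤ dist x z := by
        cases b' with
        | false => exact h3 x hx z hz
        | true =>
          obtain ⟨s, hs, hd⟩ := h4 x hx z hz
          exact (dist_triangle _ _ _).trans hd
      -- Peel off the last letter: the path to `r w` crosses the new mirror at `s`, and from `s`,
      -- which lies in the chamber, the induction hypothesis bounds the distance to `y` by the
      -- distance to `w`.
      obtain ⟨s, hs, hd2, -⟩ := hr.exists_wall hgx hgw
      have hsQ : s ∈ Q := hQ s hs.le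
      have hsy := (ih s hsQ hs.ge).1
      have hfin : dist x s + dist s y ≤ dist x z := by linarith
      exact ⟨(dist_triangle _ _ _).trans hfin, fun _ => ⟨s, Or.inr hs, hfin⟩⟩
  -- Beyond the new mirror all points belong to `Q` and none to a wall, so an old orbit meets this
  -- half plane only in its own base point, with even parity (`aux2`).
  have aux : ∀ p ∈ Q, ∀ b, ∀ z ∈ O p b, g z < 0 → z = p := by
    intro p hp b z hz hgz
    obtain ⟨-, -, h3, h4⟩ := hO p hp
    have hzQ := hQ z hgz.le
    cases b with
    | false =>
      have := h3 z hzQ z hz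
      rw [dist_self] at this
      exact dist_le_zero.1 this
    | true =>
      obtain ⟨s, hs, hd⟩ := h4 z hzQ z hz
      rw [dist_self] at hd
      have h1 : dist z s ≤ 0 := by linarith [dist_nonneg (x := s) (y := p)]
      have := hB s hs
      rw [← dist_le_zero.1 h1] at this
      linarith
  have aux2 : ∀ p ∈ Q, ∀ b, ∀ z ∈ O p b, g z < 0 → b = false := by
    intro p hp b z hz hgz
    cases b with
    | false => rfl
    | true =>
      obtain ⟨-, -, h3, h4⟩ := hO p hp
      obtain ⟨s, hs, hd⟩ := h4 z (hQ z hgz.le) z hz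
      rw [dist_self] at hd
      have h1 : dist z s ≤ 0 := by linarith [dist_nonneg (x := s) (y := p)]
      have := hB s hs
      rw [← dist_le_zero.1 h1] at this
      linarith
  refine ⟨fun b => {z | AmalgamOrbit O r g y b z}, .base (hO y hyQ).1, ?_, ?_, ?_⟩
  · rintro r' hr' b z hz
    rcases Set.mem_insert_iff.1 hr' with rfl | hr'
    · rcases le_or_gt 0 (g z) with hgz | hgz
      · have := AmalgamOrbit.step (b' := false) hz hgz
          (hO _ (hQ _ (hr.swap z hgz))).1
        simpa using this
      -- Here `z` lies beyond the new mirror, so by `aux` the word ends in the new reflection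
      -- itself: applying `r` again cancels that letter and does not lengthen the word.
      · cases hz with
        | base hz => exact absurd hyg (by rw [← aux y hyQ _ z hz hgz]; exact not_le.2 hgz)
        | @step b b' w _ hw hgw hz =>
          have hrw := hQ _ (hr.swap w hgw)
          have e := aux _ hrw _ z hz hgz
          have e2 := aux2 _ hrw _ z hz hgz
          subst e2
          simp only [Bool.xor_false, Bool.not_not, Set.mem_ofPred_eq]
          rw [e, hr.invol]
          exact hw
    · cases hz with
      | base hz => exact .base ((hO y hyQ).2.1 r' hr' _ z hz)
      | @step b b' w _ hw hgw hz =>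
        have := AmalgamOrbit.step hw hgw
          ((hO _ (hQ _ (hr.swap w hgw))).2.1 r' hr' _ z hz)
        simpa using this
  · rintro x ⟨hx, hgx⟩ z hz
    exact (key _ z hz hyg hyQ x hx hgx).1
  · rintro x ⟨hx, hgx⟩ z hz
    obtain ⟨s, hs, hd⟩ := (key _ z hz hyg hyQ x hx hgx).2 rfl
    exact ⟨s, hs, hd⟩

end UpperHalfPlane

/-! ### The chamber between two vertical lines and the unit circle -/

namespace UpperHalfPlane

lemma IsChamber.mono {R R' : Set (ℍ → ℍ)} {Q Q' B B' : Set ℍ} (h : IsChamber R Q B)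
    (hR : R' ⊆ R) (hQ : Q' = Q) (hB : B ⊆ B') : IsChamber R' Q' B' := by
  subst hQ
  intro y hy
  obtain ⟨O, h1, h2, h3, h4⟩ := h y hy
  refine ⟨O, h1, fun r hr => h2 r (hR hr), h3, fun x hx z hz => ?_⟩
  obtain ⟨s, hs, hd⟩ := h4 x hx z hz
  exact ⟨s, hB hs, hd⟩

/-- The chamber bounded by the lines `Re z = α`, `Re z = -β` and by the unit circle. -/
def idealChamber (α β : ℝ) : Set ℍ := {z | -β ≤ z.re ∧ z.re ≤ α ∧ 1 ≤ z.absSq}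

/-- The walls of `idealChamber α β`. -/
def idealWalls (α β : ℝ) : Set ℍ :=
  {z | z ∈ idealChamber α β ∧ (z.re = α ∨ z.re = -β ∨ z.absSq = 1)}

lemma sq_re_lt_absSq (z : ℍ) : z.re ^ 2 < z.absSq := by
  have := z.im_pos
  unfold absSq
  nlinarith

/-- For `α, β ≥ 1` the mirrors are pairwise disjoint in `ℍ` because `(Re z)² < |z|²`, so the mirrors
can be inserted one at a time into the empty system. -/
lemma isChamber_of_one_le {α β : ℝ} (hα : 1 ≤ α) (hβ : 1 ≤ β) :
    IsChamber {reflUnit, reflLine α, reflLine (-β)} (idealChamber α β) (idealWalls α β) := by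
  have m2 : IsMirror (reflLine (-β)) (fun z => z.re + β) := by
    simpa using (isMirror_reflLine (-β)).neg
  have h1 := isChamber_univ.insert isMirror_reflUnit (by simp) (by simp)
  have h2 := h1.insert (isMirror_reflLine α)
    (fun z hz => ⟨trivial, by
      have := sq_re_lt_absSq z
      simp only [Set.mem_ofPred_eq]
      nlinarith⟩)
    (fun z hz => by
      have := sq_re_lt_absSq z
      simp only [Set.empty_union, Set.mem_ofPred_eq] at hz
      by_contra hc
      nlinarith)
  have h3 := h2.insert m2
    (fun z hz => by
      have := sq_re_lt_absSq z
      simp only [Set.mem_inter_iff, Set.mem_ofPred_eq, Set.mem_univ, true_and]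
      constructor <;> nlinarith)
    (fun z hz => by
      have := sq_re_lt_absSq z
      simp only [Set.empty_union, Set.mem_ofPred_eq, Set.mem_union] at hz
      by_contra hc
      rcases hz with hz | hz <;> nlinarith)
  refine h3.mono ?_ ?_ ?_
  · intro r hr
    simp only [Set.mem_insert_iff, Set.mem_singleton_iff] at hr ⊢
    tauto
  · ext z
    simp only [idealChamber, Set.mem_inter_iff, Set.mem_ofPred_eq, Set.mem_univ, true_and]
    constructor
    · rintro ⟨a, b, c⟩; exact ⟨⟨by linarith, by linarith⟩, by linarith⟩
    · rintro ⟨⟨a, b⟩, c⟩; exact ⟨by linarith, by linarith, by linarith⟩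
  · intro z hz
    have := sq_re_lt_absSq z
    simp only [Set.empty_union, Set.mem_ofPred_eq, Set.mem_union] at hz
    simp only [idealWalls, idealChamber, Set.mem_ofPred_eq]
    rcases hz with (hz | hz) | hz
    · exact ⟨⟨by nlinarith, by nlinarith, by nlinarith⟩, Or.inr (Or.inr (by linarith))⟩
    · exact ⟨⟨by nlinarith, by nlinarith, by nlinarith⟩, Or.inl (by linarith)⟩
    · exact ⟨⟨by nlinarith, by nlinarith, by nlinarith⟩, Or.inr (Or.inl (by linarith))⟩

/-- With `d = π / n` and `j` reduced modulo `n` to `i`, the difference of the cosines is `2 sin (i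
d) sin (i d - s)`, and for `1 ≤ i < n` both arguments lie in `[0, π]`. -/
lemma cos_sub_le_cos {n : ℕ} (hn : 1 ≤ n) {s : ℝ} (hs : |s| ≤ Real.pi / n) (j : ℤ) :
    Real.cos (s - 2 * j * (Real.pi / n)) ≤ Real.cos s := by
  have hn0 : (0 : ℝ) < n := by exact_mod_cast hn
  have hnz : (n : ℤ) ≠ 0 := by omega
  have hpi := Real.pi_pos
  obtain ⟨i, hi⟩ : ∃ i, i = j % n := ⟨_, rfl⟩
  have hi0 : 0 ≤ i := hi ▸ Int.emod_nonneg j hnz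
  have hin : i < n := hi ▸ Int.emod_lt_of_pos j (by omega)
  have hj : j = i + n * (j / n) := by rw [hi, Int.emod_add_mul_ediv]
  have e : s - 2 * j * (Real.pi / n)
      = (s - 2 * i * (Real.pi / n)) - ((j / n : ℤ) : ℝ) * (2 * Real.pi) := by
    have : (j : ℝ) = i + n * ((j / n : ℤ) : ℝ) := by exact_mod_cast hj
    rw [this]
    field_simp
    ring
  rw [e, Real.cos_sub_int_mul_two_pi]
  rcases hi0.eq_or_lt with h | h
  · rw [← h]; simp
  · have hi1 : (1 : ℝ) ≤ i := by exact_mod_cast h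
    have hin1 : (i : ℝ) ≤ n := by exact_mod_cast hin.le
    obtain ⟨d, hd⟩ : ∃ d, d = Real.pi / n := ⟨_, rfl⟩
    have hnd : (n : ℝ) * d = Real.pi := by rw [hd]; field_simp
    have hd0 : 0 < d := by rw [hd]; positivity
    rw [← hd] at hs ⊢
    obtain ⟨hs1, hs2⟩ := abs_le.1 hs
    have key : Real.cos s - Real.cos (s - 2 * i * d)
        = 2 * (Real.sin (i * d) * Real.sin (i * d - s)) := by
      rw [Real.cos_sub_cos, show (s + (s - 2 * i * d)) / 2 = -(i * d - s) by ring,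
        show (s - (s - 2 * i * d)) / 2 = i * d by ring, Real.sin_neg]
      ring
    have hin2 : (i : ℝ) + 1 ≤ n := by exact_mod_cast hin
    have h1 : 0 ≤ Real.sin (i * d) :=
      Real.sin_nonneg_of_nonneg_of_le_pi (by positivity) (by nlinarith)
    have h2 : 0 ≤ Real.sin (i * d - s) :=
      Real.sin_nonneg_of_nonneg_of_le_pi (by nlinarith) (by nlinarith)
    have := mul_nonneg h1 h2
    linarith

/-! ### Polar coordinates at the vertex and the dihedral group -/

/-- The first coordinate of a point in the hyperboloid model centered at `e^{iθ}`. -/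
noncomputable def coneX (θ : ℝ) (z : ℍ) : ℝ :=
  (z.absSq - 1 + 2 * Real.cos θ ^ 2 - 2 * z.re * Real.cos θ) / (2 * z.im * Real.sin θ)

/-- The second coordinate of a point in the hyperboloid model centered at `e^{iθ}`. -/
noncomputable def coneY (θ : ℝ) (z : ℍ) : ℝ := (Real.cos θ - z.re) / z.im

/-- The time coordinate of a point in the hyperboloid model centered at `e^{iθ}`. -/
noncomputable def coneT (θ : ℝ) (z : ℍ) : ℝ :=
  (z.absSq + 1 - 2 * z.re * Real.cos θ) / (2 * z.im * Real.sin θ)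

section cone

variable {θ : ℝ}

lemma cosh_dist_cone (hs : 0 < Real.sin θ) (z w : ℍ) : Real.cosh (dist z w) =
    coneT θ z * coneT θ w - (coneX θ z * coneX θ w + coneY θ z * coneY θ w) := by
  have hz := z.im_pos
  have hw := w.im_pos
  rw [cosh_dist_eq_absSq]
  unfold coneT coneX coneY
  have h := Real.sin_sq_add_cos_sq θ
  field_simp
  linear_combination (2 * z.absSq + 2 * w.absSq - 4 * z.re * Real.cos θ - 4 * w.re * Real.cos θ +
    4 * Real.cos θ ^ 2) * h

lemma coneT_sq (hs : 0 < Real.sin θ) (z : ℍ) :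
    coneT θ z ^ 2 = 1 + coneX θ z ^ 2 + coneY θ z ^ 2 := by
  have := cosh_dist_cone hs z z
  rw [dist_self, Real.cosh_zero] at this
  linear_combination -this

lemma coneT_pos (hs : 0 < Real.sin θ) (z : ℍ) : 0 < coneT θ z := by
  have hz := z.im_pos
  have h := Real.sin_sq_add_cos_sq θ
  have : 0 < z.absSq + 1 - 2 * z.re * Real.cos θ := by
    unfold absSq
    nlinarith [sq_nonneg (z.re - Real.cos θ), mul_pos hz hz]
  unfold coneT
  positivity

lemma coneX_reflLine (z : ℍ) : coneX θ (reflLine (Real.cos θ) z) = coneX θ z := by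
  unfold coneX absSq
  simp only [reflLine_re, reflLine_im]
  ring

lemma coneY_reflLine (z : ℍ) : coneY θ (reflLine (Real.cos θ) z) = -coneY θ z := by
  unfold coneY
  simp only [reflLine_re, reflLine_im]
  ring

/-- About `e^{iθ}` the unit circle is the ray of angle `θ` and the line `Re z = cos θ` the ray of
angle `0`; the two reflections act on `(X, Y)` as the linear reflections in these directions. -/
lemma coneX_reflUnit (hs : 0 < Real.sin θ) (z : ℍ) : coneX θ (reflUnit z) =
    Real.cos (2 * θ) * coneX θ z + Real.sin (2 * θ) * coneY θ z := by
  have hz := z.im_pos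
  have hN := z.absSq_pos
  unfold coneX coneY
  have h := Real.sin_sq_add_cos_sq θ
  have h2 : Real.sin θ ^ 2 = 1 - Real.cos θ ^ 2 := by linarith
  rw [reflUnit_absSq, Real.cos_two_mul, Real.sin_two_mul]
  simp only [reflUnit_re, reflUnit_im]
  field_simp
  rw [h2]
  ring

lemma coneY_reflUnit (hs : 0 < Real.sin θ) (z : ℍ) : coneY θ (reflUnit z) =
    Real.sin (2 * θ) * coneX θ z - Real.cos (2 * θ) * coneY θ z := by
  have hz := z.im_pos
  have hN := z.absSq_pos
  unfold coneX coneY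
  rw [Real.cos_two_mul, Real.sin_two_mul]
  simp only [reflUnit_re, reflUnit_im]
  field_simp
  ring

lemma exists_polar (h0 : 0 < θ) (h1 : θ ≤ Real.pi / 2) {z : ℍ} (hre : z.re ≤ Real.cos θ)
    (hab : 1 ≤ z.absSq) : ∃ ρ φ : ℝ, 0 ≤ ρ ∧ 0 ≤ φ ∧ φ ≤ θ ∧ coneX θ z = ρ * Real.cos φ ∧
      coneY θ z = ρ * Real.sin φ := by
  have hpi := Real.pi_pos
  have hs : 0 < Real.sin θ := Real.sin_pos_of_pos_of_lt_pi h0 (by linarith)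
  have hz := z.im_pos
  set q : ℂ := ⟨coneX θ z, coneY θ z⟩ with hq
  have hx : coneX θ z = ‖q‖ * Real.cos q.arg := (Complex.norm_mul_cos_arg q).symm
  have hy : coneY θ z = ‖q‖ * Real.sin q.arg := (Complex.norm_mul_sin_arg q).symm
  have hy0 : 0 ≤ coneY θ z := div_nonneg (by linarith) hz.le
  have ha0 : 0 ≤ q.arg := Complex.arg_nonneg_iff.2 hy0
  have hapi := Complex.arg_le_pi q
  refine ⟨‖q‖, q.arg, norm_nonneg _, ha0, ?_, hx, hy⟩
  by_contra! hc
  have hq0 : q ≠ 0 := by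
    rintro h
    rw [h, Complex.arg_zero] at hc
    linarith
  have hn : 0 < ‖q‖ := norm_pos_iff.2 hq0
  -- The sign of `|z|² - 1` decides on which side of the direction `θ` the point lies.
  have e : Real.sin θ * coneX θ z - Real.cos θ * coneY θ z = (z.absSq - 1) / (2 * z.im) := by
    unfold coneX coneY
    field_simp
    ring
  have e2 : Real.sin θ * coneX θ z - Real.cos θ * coneY θ z
      = -(‖q‖ * Real.sin (q.arg - θ)) := by
    rw [Real.sin_sub, hx, hy]; ring
  have h3 : 0 ≤ (z.absSq - 1) / (2 * z.im) := div_nonneg (by linarith) (by linarith)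
  have h4 : 0 < Real.sin (q.arg - θ) :=
    Real.sin_pos_of_pos_of_lt_pi (by linarith) (by linarith)
  have := mul_pos hn h4
  linarith

/-- The time coordinate depends only on the radius, so for all points of an orbit the distance to
`x` is governed by the cosine of the angle alone. -/
lemma cosh_dist_polar (hs : 0 < Real.sin θ) {x y z : ℍ} {a φ b ζ : ℝ}
    (hx1 : coneX θ x = a * Real.cos φ) (hx2 : coneY θ x = a * Real.sin φ)
    (hz1 : coneX θ z = b * Real.cos ζ) (hz2 : coneY θ z = b * Real.sin ζ)
    (hy : coneX θ y ^ 2 + coneY θ y ^ 2 = b ^ 2) :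
    Real.cosh (dist x z) = coneT θ x * coneT θ y - a * b * Real.cos (φ - ζ) := by
  have hT : coneT θ z = coneT θ y := by
    have h1 := coneT_sq hs z
    have h2 := coneT_sq hs y
    refine (sq_eq_sq₀ (coneT_pos hs z).le (coneT_pos hs y).le).1 ?_
    rw [h1, h2, hz1, hz2]
    linear_combination b ^ 2 * Real.sin_sq_add_cos_sq ζ - hy
  rw [cosh_dist_cone hs, hT, hx1, hx2, hz1, hz2, Real.cos_sub]
  ring

/-- If `y` has angle `ψ`, its even orbit has the angles `ψ + 2jθ` and its odd orbit the angles `-ψ +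
2jθ`. Since `θ = π / n`, `cos_sub_le_cos` identifies the orbit points nearest to a point of the
sector. -/
lemma isChamber_dihedral {n : ℕ} (hn : 2 ≤ n) (hθ : θ = Real.pi / n) :
    IsChamber {reflUnit, reflLine (Real.cos θ)} {z | z.re ≤ Real.cos θ ∧ 1 ≤ z.absSq}
      {z | (z.re ≤ Real.cos θ ∧ 1 ≤ z.absSq) ∧ (z.re = Real.cos θ ∨ z.absSq = 1)} := by
  have hpi := Real.pi_pos
  have hn2 : (2 : ℝ) ≤ n := by exact_mod_cast hn
  have h0 : 0 < θ := by rw [hθ]; positivity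
  have h1 : θ ≤ Real.pi / 2 := by rw [hθ]; gcongr
  have hs : 0 < Real.sin θ := Real.sin_pos_of_pos_of_lt_pi h0 (by linarith)
  have hL : ∀ s, |s| ≤ θ → ∀ j : ℤ, Real.cos (s - 2 * j * θ) ≤ Real.cos s := fun s hs j => by
    rw [hθ] at hs ⊢
    exact cos_sub_le_cos (by omega) hs j
  rintro y ⟨hy1, hy2⟩
  obtain ⟨b, ψ, hb, hψ0, hψ1, hyX, hyY⟩ := exists_polar h0 h1 hy1 hy2
  have hyb : coneX θ y ^ 2 + coneY θ y ^ 2 = b ^ 2 := by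
    rw [hyX, hyY]; linear_combination b ^ 2 * Real.sin_sq_add_cos_sq ψ
  refine ⟨fun c => {z | ∃ j : ℤ,
    coneX θ z = b * Real.cos ((if c then -ψ else ψ) + 2 * j * θ) ∧
    coneY θ z = b * Real.sin ((if c then -ψ else ψ) + 2 * j * θ)}, ?_, ?_, ?_, ?_⟩
  · exact ⟨0, by simpa using hyX, by simpa using hyY⟩
  · intro r hr c z hz
    obtain ⟨j, hX, hY⟩ := hz
    have hc : (if !c then -ψ else ψ) = -(if c then -ψ else ψ) := by cases c <;> simp
    generalize hσ : (if c then -ψ else ψ) = σ at hX hY hc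
    show ∃ j : ℤ, _
    rw [hc]
    rcases hr with rfl | rfl
    · refine ⟨1 - j, ?_, ?_⟩
      · rw [coneX_reflUnit hs, hX, hY,
          show -σ + 2 * ((1 - j : ℤ) : ℝ) * θ = 2 * θ - (σ + 2 * j * θ) by push_cast; ring,
          Real.cos_sub]
        ring
      · rw [coneY_reflUnit hs, hX, hY,
          show -σ + 2 * ((1 - j : ℤ) : ℝ) * θ = 2 * θ - (σ + 2 * j * θ) by push_cast; ring,
          Real.sin_sub]
        ring
    · refine ⟨-j, ?_, ?_⟩
      · rw [coneX_reflLine, hX,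
          show -σ + 2 * ((-j : ℤ) : ℝ) * θ = -(σ + 2 * j * θ) by push_cast; ring, Real.cos_neg]
      · rw [coneY_reflLine, hY,
          show -σ + 2 * ((-j : ℤ) : ℝ) * θ = -(σ + 2 * j * θ) by push_cast; ring, Real.sin_neg]
        ring
  · rintro x ⟨hx1, hx2⟩ z ⟨j, hX, hY⟩
    simp only [Bool.false_eq_true, if_false] at hX hY
    obtain ⟨a, φ, ha, hφ0, hφ1, hxX, hxY⟩ := exists_polar h0 h1 hx1 hx2
    rw [dist_le_dist_iff_cosh, cosh_dist_polar hs hxX hxY hX hY hyb,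
      cosh_dist_polar hs hxX hxY hyX hyY hyb]
    have := hL (φ - ψ) (abs_le.2 ⟨by linarith, by linarith⟩) j
    rw [show φ - (ψ + 2 * j * θ) = φ - ψ - 2 * j * θ by ring]
    have := mul_le_mul_of_nonneg_left this (mul_nonneg ha hb)
    linarith
  · rintro x ⟨hx1, hx2⟩ z ⟨j, hX, hY⟩
    simp only [if_true] at hX hY
    obtain ⟨a, φ, ha, hφ0, hφ1, hxX, hxY⟩ := exists_polar h0 h1 hx1 hx2
    have hxi : x.im ≠ 0 := x.im_ne_zero
    -- The nearest point of the odd orbit has angle `-ψ` or `2θ - ψ`, that is, it is the reflection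
    -- of `y` in the line or in the unit circle.
    rcases le_total (φ + ψ) θ with hle | hle
    · have hd : dist x (reflLine (Real.cos θ) y) ≤ dist x z := by
        have e1 : coneX θ (reflLine (Real.cos θ) y) = b * Real.cos (-ψ) := by
          rw [coneX_reflLine, hyX, Real.cos_neg]
        have e2 : coneY θ (reflLine (Real.cos θ) y) = b * Real.sin (-ψ) := by
          rw [coneY_reflLine, hyY, Real.sin_neg]; ring
        rw [dist_le_dist_iff_cosh, cosh_dist_polar hs hxX hxY hX hY hyb,
          cosh_dist_polar hs hxX hxY e1 e2 hyb]
        have := hL (φ + ψ) (abs_le.2 ⟨by linarith, by linarith⟩) j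
        rw [show φ - (-ψ + 2 * j * θ) = φ + ψ - 2 * j * θ by ring, sub_neg_eq_add]
        have := mul_le_mul_of_nonneg_left this (mul_nonneg ha hb)
        linarith
      obtain ⟨s, hsw, hsd, hsg⟩ := (isMirror_reflLine (Real.cos θ)).exists_wall (x := x) (y := y)
        (by linarith) (by linarith)
      have hsre : s.re = Real.cos θ := by linarith
      have hg : ∀ w : ℍ, w.absSq - 1 + 2 * Real.cos θ ^ 2 - 2 * w.re * Real.cos θ
          = coneX θ w * (2 * w.im * Real.sin θ) := fun w => by
        have := w.im_ne_zero
        unfold coneX; field_simp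
      -- The half plane `X ≥ 0` contains `x` and the reflected point, hence also `s`; on the line
      -- `Re z = cos θ` this says `|s| ≥ 1`.
      have := hsg (fun w => w.absSq - 1 + 2 * Real.cos θ ^ 2 - 2 * w.re * Real.cos θ)
        ⟨-1 + 2 * Real.cos θ ^ 2, -2 * Real.cos θ, 1, fun w => by ring⟩
        (by
          have := x.im_pos
          have := Real.cos_nonneg_of_neg_pi_div_two_le_of_le (x := φ) (by linarith) (by linarith)
          simp only [hg, hxX]; positivity)
        (by
          have := y.im_pos
          have := Real.cos_nonneg_of_neg_pi_div_two_le_of_le (x := ψ) (by linarith) (by linarith)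
          simp only [hg, coneX_reflLine, hyX, reflLine_im]; positivity)
      simp only [hsre] at this
      exact ⟨s, ⟨⟨hsre.le, by nlinarith⟩, Or.inl hsre⟩, hsd.trans hd⟩
    · have e1 : coneX θ (reflUnit y) = b * Real.cos (2 * θ - ψ) := by
        rw [coneX_reflUnit hs, hyX, hyY, Real.cos_sub]; ring
      have e2 : coneY θ (reflUnit y) = b * Real.sin (2 * θ - ψ) := by
        rw [coneY_reflUnit hs, hyX, hyY, Real.sin_sub]; ring
      have hd : dist x (reflUnit y) ≤ dist x z := by
        rw [dist_le_dist_iff_cosh, cosh_dist_polar hs hxX hxY hX hY hyb,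
          cosh_dist_polar hs hxX hxY e1 e2 hyb]
        have := hL (2 * θ - (φ + ψ)) (abs_le.2 ⟨by linarith, by linarith⟩) (1 - j)
        rw [← Real.cos_neg (φ - (-ψ + 2 * j * θ)), ← Real.cos_neg (φ - (2 * θ - ψ)),
          show -(φ - (-ψ + 2 * j * θ)) = 2 * θ - (φ + ψ) - 2 * ((1 - j : ℤ) : ℝ) * θ by
            push_cast; ring,
          show -(φ - (2 * θ - ψ)) = 2 * θ - (φ + ψ) by ring]
        have := mul_le_mul_of_nonneg_left this (mul_nonneg ha hb)
        linarith
      obtain ⟨s, hsw, hsd, hsg⟩ := isMirror_reflUnit.exists_wall (x := x) (y := y)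
        (by linarith) (by linarith)
      have hsab : s.absSq = 1 := by linarith
      have hg : ∀ w : ℍ, Real.cos θ * (w.absSq - 1) + 2 * (Real.cos θ - w.re)
          = (Real.cos θ * coneX θ w + Real.sin θ * coneY θ w) * (2 * w.im * Real.sin θ) :=
        fun w => by
          have := w.im_ne_zero
          unfold coneX coneY; field_simp
          have h2 : Real.sin θ ^ 2 = 1 - Real.cos θ ^ 2 := by
            linarith [Real.sin_sq_add_cos_sq θ]
          rw [h2]
          ring
      have hc : ∀ w : ℍ, ∀ (c ζ : ℝ), coneX θ w = c * Real.cos ζ → coneY θ w = c * Real.sin ζ →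
          Real.cos θ * coneX θ w + Real.sin θ * coneY θ w = c * Real.cos (θ - ζ) :=
        fun w c ζ h1 h2 => by rw [h1, h2, Real.cos_sub]; ring
      -- The same with the half plane of angles at most `π / 2` from the direction `θ`; on the unit
      -- circle it says `Re s ≤ cos θ`.
      have := hsg (fun w => Real.cos θ * (w.absSq - 1) + 2 * (Real.cos θ - w.re))
        ⟨Real.cos θ, -2, Real.cos θ, fun w => by ring⟩
        (by
          have := x.im_pos
          have := Real.cos_nonneg_of_neg_pi_div_two_le_of_le (x := θ - φ) (by linarith)
            (by linarith)
          simp only [hg, hc x _ _ hxX hxY]; positivity)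
        (by
          have := (reflUnit y).im_pos
          have := Real.cos_nonneg_of_neg_pi_div_two_le_of_le (x := θ - (2 * θ - ψ)) (by linarith)
            (by linarith)
          simp only [hg, hc _ _ _ e1 e2]; positivity)
      simp only [hsab] at this
      exact ⟨s, ⟨⟨by linarith, hsab.ge⟩, Or.inr hsab⟩, hsd.trans hd⟩

/-- The line `Re z = -β` and everything to its left lie inside the sector and miss its walls, since
`β ≥ 1`, so one insertion is enough. -/
lemma isChamber_of_pi_div {n : ℕ} (hn : 2 ≤ n) (hθ : θ = Real.pi / n) {β : ℝ} (hβ : 1 ≤ β) :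
    IsChamber {reflUnit, reflLine (Real.cos θ), reflLine (-β)} (idealChamber (Real.cos θ) β)
      (idealWalls (Real.cos θ) β) := by
  have hpi := Real.pi_pos
  have hn2 : (2 : ℝ) ≤ n := by exact_mod_cast hn
  have h0 : 0 < θ := by rw [hθ]; positivity
  have h1 : θ ≤ Real.pi / 2 := by rw [hθ]; gcongr
  have hc0 : 0 ≤ Real.cos θ := Real.cos_nonneg_of_neg_pi_div_two_le_of_le (by linarith) h1
  have m2 : IsMirror (reflLine (-β)) (fun z => z.re + β) := by
    simpa using (isMirror_reflLine (-β)).neg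
  have h3 := (isChamber_dihedral hn hθ).insert m2
    (fun z hz => by
      have := sq_re_lt_absSq z
      simp only [Set.mem_ofPred_eq]
      constructor <;> nlinarith)
    (fun z hz => by
      have := sq_re_lt_absSq z
      simp only [Set.mem_ofPred_eq] at hz
      by_contra hc
      rcases hz with ⟨hz, hz' | hz'⟩ <;> nlinarith)
  refine h3.mono ?_ ?_ ?_
  · intro r hr
    simp only [Set.mem_insert_iff, Set.mem_singleton_iff] at hr ⊢
    tauto
  · ext z
    simp only [idealChamber, Set.mem_inter_iff, Set.mem_ofPred_eq]
    constructor
    · rintro ⟨a, b, c⟩; exact ⟨⟨by linarith, by linarith⟩, by linarith⟩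
    · rintro ⟨⟨a, b⟩, c⟩; exact ⟨by linarith, by linarith, by linarith⟩
  · intro z hz
    have := sq_re_lt_absSq z
    simp only [Set.mem_ofPred_eq, Set.mem_union] at hz
    simp only [idealWalls, idealChamber, Set.mem_ofPred_eq]
    rcases hz with ⟨⟨hz1, hz2⟩, hz⟩ | hz
    · refine ⟨⟨?_, hz1, hz2⟩, by tauto⟩
      by_contra hc
      rcases hz with hz | hz <;> nlinarith
    · exact ⟨⟨by nlinarith, by nlinarith, by nlinarith⟩, Or.inr (Or.inl (by linarith))⟩

end cone

end UpperHalfPlane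

/-! ### From the ideal chamber to the truncated half piece -/

namespace UpperHalfPlane

/-- Corner of the truncated chamber: a wall point inside the disc orthogonal to the line
`Re z = α` and the unit circle can be replaced by a closer one outside. -/
lemma exists_corner {α β : ℝ} (hα0 : 0 ≤ α) (hβ : 0 ≤ β) {s : ℍ} (hs : s ∈ idealWalls α β)
    (hlt : s.absSq + 1 < 2 * α * s.re) :
    ∃ s' ∈ idealWalls α β, 2 * α * s'.re ≤ s'.absSq + 1 ∧ -(2 * β * s'.re) ≤ s'.absSq + 1 ∧
      ∀ x : ℍ, 2 * α * x.re ≤ x.absSq + 1 → dist x s' ≤ dist x s := by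
  obtain ⟨⟨hs1, hs2, hs3⟩, hs4⟩ := hs
  have hsi := s.im_pos
  have hsa : s.absSq = s.re ^ 2 + s.im ^ 2 := rfl
  have hα : 1 < α := by
    by_contra hc
    push Not at hc
    rcases lt_or_ge 0 s.re with h | h
    · have : α * s.re ≤ s.re := by nlinarith
      nlinarith [sq_nonneg (s.re - 1)]
    · nlinarith [mul_nonneg hα0 (neg_nonneg.2 h), s.absSq_pos]
  have hre : 0 < s.re := by
    by_contra hc
    push Not at hc
    nlinarith
  rcases hs4 with h | h | h
  -- The corner is `α + i √(α² - 1)`, where the line meets the truncating circle.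
  · have hR : 0 < α ^ 2 - 1 := by nlinarith
    have hR2 := Real.sq_sqrt hR.le
    have hR0 := Real.sqrt_pos.2 hR
    obtain ⟨R, hRd⟩ : ∃ R, R = √(α ^ 2 - 1) := ⟨_, rfl⟩
    rw [← hRd] at hR2 hR0
    have hab : absSq ⟨⟨α, R⟩, hR0⟩ = 2 * α ^ 2 - 1 := by
      simp only [absSq, mk_re, mk_im]; linarith
    refine ⟨⟨⟨α, R⟩, hR0⟩, ⟨⟨?_, ?_, ?_⟩, Or.inl rfl⟩, ?_, ?_, ?_⟩
    · simp only [mk_re]; linarith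
    · simp only [mk_re]; linarith
    · rw [hab]; nlinarith
    · rw [hab]; simp only [mk_re]; nlinarith
    · rw [hab]; simp only [mk_re]; nlinarith [mul_nonneg hβ (by linarith : (0:ℝ) ≤ α)]
    · intro x hx
      have hxi := x.im_pos
      have htR : s.im ≤ R := by
        rw [hsa, h] at hlt
        nlinarith
      rw [dist_le_dist_iff_cosh, cosh_dist_eq_absSq, cosh_dist_eq_absSq, hab]
      simp only [mk_re, mk_im]
      rw [hsa, h, div_le_div_iff₀ (by positivity) (by positivity)]
      have h1 : 0 ≤ (R - s.im) * ((x.absSq + α ^ 2 - 2 * α * x.re) - s.im * R) := by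
        apply mul_nonneg (by linarith)
        nlinarith
      have h2 := mul_nonneg hxi.le h1
      have h3 : x.im * (2 * α ^ 2 - 1) = x.im * (α ^ 2 + R ^ 2) := by rw [hR2]; ring
      have e : (x.absSq + (α ^ 2 + s.im ^ 2) - 2 * x.re * α) * (2 * x.im * R) -
        (x.absSq + (2 * α ^ 2 - 1) - 2 * x.re * α) * (2 * x.im * s.im) =
        2 * (x.im * ((R - s.im) * (x.absSq + α ^ 2 - 2 * α * x.re - s.im * R))) := by
        linear_combination (-2 * s.im) * h3
      linarith
  · linarith
  -- The corner on the unit circle has real part `1 / α`, since the truncating circle is `|z|² + 1 =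
  -- 2 α Re z`.
  · have hX' : 0 < 1 - (1 / α) ^ 2 := by
      have : (1 / α) ^ 2 < 1 := by
        rw [div_pow, one_pow, div_lt_one (by positivity)]; nlinarith
      linarith
    have hY2 := Real.sq_sqrt hX'.le
    have hY0 := Real.sqrt_pos.2 hX'
    obtain ⟨Y, hYd⟩ : ∃ Y, Y = √(1 - (1 / α) ^ 2) := ⟨_, rfl⟩
    obtain ⟨X, hXd⟩ : ∃ X, X = 1 / α := ⟨_, rfl⟩
    rw [← hYd, ← hXd] at hY2
    rw [← hYd] at hY0
    have hX0 : 0 < X := by rw [hXd]; positivity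
    have hαX : α * X = 1 := by rw [hXd]; field_simp
    have hab : absSq ⟨⟨X, Y⟩, hY0⟩ = 1 := by
      simp only [absSq, mk_re, mk_im]; linarith
    refine ⟨⟨⟨X, Y⟩, hY0⟩, ⟨⟨?_, ?_, ?_⟩, Or.inr (Or.inr hab)⟩, ?_, ?_, ?_⟩
    · simp only [mk_re]; linarith
    · simp only [mk_re]; nlinarith
    · rw [hab]
    · rw [hab]; simp only [mk_re]; nlinarith
    · rw [hab]; simp only [mk_re]; nlinarith [mul_nonneg hβ hX0.le]
    · intro x hx
      have hxi := x.im_pos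
      rw [h] at hlt
      have hXs : X < s.re := by nlinarith
      have hYs : s.im ≤ Y := by nlinarith
      have hCS : X * s.re + Y * s.im ≤ 1 := by
        nlinarith [sq_nonneg (X - s.re), sq_nonneg (Y - s.im)]
      rw [dist_le_dist_iff_cosh, cosh_dist_eq_absSq, cosh_dist_eq_absSq, hab, h]
      simp only [mk_re, mk_im]
      rw [div_le_div_iff₀ (by positivity) (by positivity)]
      have key : (x.absSq + 1 - 2 * x.re * X) * s.im ≤ (x.absSq + 1 - 2 * x.re * s.re) * Y := by
        obtain ⟨δ, hδ⟩ : ∃ δ, δ = x.absSq + 1 - 2 * α * x.re := ⟨_, rfl⟩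
        have hδ0 : 0 ≤ δ := by linarith
        have hM : x.absSq + 1 = 2 * α * x.re + δ := by linarith
        have hδY := mul_le_mul_of_nonneg_left hYs hδ0
        rcases le_total 0 x.re with hx0 | hx0
        · have h5 : (α - X) * s.im ≤ (α - s.re) * Y := by
            have e1 : α - X = α * Y ^ 2 := by
              rw [hY2]; linear_combination X * hαX
            have e2 : α - s.re = α * (1 - X * s.re) := by linear_combination s.re * hαX
            rw [e1, e2]
            have : 0 ≤ α * Y * (1 - X * s.re - Y * s.im) := by
              apply mul_nonneg (by positivity); linarith
            linarith
          have h6 := mul_le_mul_of_nonneg_left h5 hx0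
          rw [hM]
          linarith
        · have h5 : x.absSq + 1 - 2 * x.re * X ≤ x.absSq + 1 - 2 * x.re * s.re := by
            linarith [mul_nonneg (neg_nonneg.2 hx0) (sub_nonneg.2 hXs.le)]
          have h6 : 0 ≤ x.absSq + 1 - 2 * x.re * X := by
            linarith [x.absSq_pos, mul_nonneg (neg_nonneg.2 hx0) hX0.le]
          exact mul_le_mul h5 hYs hsi.le (h6.trans h5)
      linarith [mul_le_mul_of_nonneg_left key hxi.le]

lemma reflLine_zero_mem_idealWalls {α β : ℝ} {s : ℍ} (hs : s ∈ idealWalls α β) :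
    reflLine 0 s ∈ idealWalls β α := by
  obtain ⟨⟨h1, h2, h3⟩, h4⟩ := hs
  have hab : (reflLine 0 s).absSq = s.absSq := by
    unfold absSq; simp
  simp only [idealWalls, idealChamber, Set.mem_ofPred_eq, hab, reflLine_re]
  refine ⟨⟨by linarith, by linarith, h3⟩, ?_⟩
  rcases h4 with h | h | h
  · exact Or.inr (Or.inl (by linarith))
  · exact Or.inl (by linarith)
  · exact Or.inr (Or.inr h)

lemma reflLine_zero_absSq (z : ℍ) : (reflLine 0 z).absSq = z.absSq := by
  unfold absSq; simp

lemma mem_halfPiece_iff {α β : ℝ≥0} {z : ℍ} : z ∈ halfPiece α β ↔ z ∈ idealChamber α β ∧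
    2 * α * z.re ≤ z.absSq + 1 ∧ -(2 * β * z.re) ≤ z.absSq + 1 := by
  simp only [halfPiece, idealChamber, absSq, Set.mem_ofPred_eq]
  constructor
  · rintro ⟨h1, h2, h3, h4, h5⟩
    exact ⟨⟨h1, h2, h3⟩, by linarith, by linarith⟩
  · rintro ⟨⟨h1, h2, h3⟩, h4, h5⟩
    exact ⟨h1, h2, h3, by linarith, by linarith⟩

lemma mem_halfPieceSeams_iff {α β : ℝ≥0} {p : halfPiece α β} :
    p ∈ halfPieceSeams α β ↔ p.1 ∈ idealWalls α β := by
  have := (mem_halfPiece_iff.1 p.2).1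
  exact ⟨fun h => ⟨this, h⟩, fun h => h.2⟩

/-- A path between points of the half piece meeting the walls of the ideal chamber can be replaced
by one meeting the seams. -/
lemma exists_seam {α β : ℝ≥0} (x y : halfPiece α β) {s : ℍ} (hs : s ∈ idealWalls α β) :
    ∃ s' : halfPieceSeams α β,
      dist x.1 s'.1.1 + dist s'.1.1 y.1 ≤ dist x.1 s + dist s y.1 := by
  obtain ⟨-, hx1, hx2⟩ := mem_halfPiece_iff.1 x.2
  obtain ⟨-, hy1, hy2⟩ := mem_halfPiece_iff.1 y.2
  by_cases h1 : 2 * α * s.re ≤ s.absSq + 1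
  · by_cases h2 : -(2 * β * s.re) ≤ s.absSq + 1
    · exact ⟨⟨⟨s, mem_halfPiece_iff.2 ⟨hs.1, h1, h2⟩⟩, mem_halfPieceSeams_iff.2 hs⟩, le_rfl⟩
    -- The reflection in the imaginary axis exchanges `α` and `β` and reduces this corner to the
    -- other one.
    · have hlt : (reflLine 0 s).absSq + 1 < 2 * β * (reflLine 0 s).re := by
        rw [reflLine_zero_absSq, reflLine_re]; linarith
      obtain ⟨s', hs', h3, h4, h5⟩ :=
        exists_corner β.coe_nonneg α.coe_nonneg (reflLine_zero_mem_idealWalls hs) hlt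
      have hw := reflLine_zero_mem_idealWalls hs'
      have hd : ∀ p : ℍ, -(2 * β * p.re) ≤ p.absSq + 1 →
          dist p (reflLine 0 s') ≤ dist p s := fun p hp => by
        have := h5 (reflLine 0 p) (by rw [reflLine_zero_absSq, reflLine_re]; linarith)
        rwa [(isMirror_reflLine 0).isom, (isMirror_reflLine 0).dist_comm] at this
      refine ⟨⟨⟨reflLine 0 s', mem_halfPiece_iff.2 ⟨hw.1, ?_, ?_⟩⟩,
        mem_halfPieceSeams_iff.2 hw⟩, ?_⟩
      · rw [reflLine_zero_absSq, reflLine_re]; linarith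
      · rw [reflLine_zero_absSq, reflLine_re]; linarith
      · have e1 := hd _ hx2
        have e2 := hd _ hy2
        rw [dist_comm _ y.1, dist_comm s y.1]
        linarith
  · obtain ⟨s', hs', h3, h4, h5⟩ := exists_corner α.coe_nonneg β.coe_nonneg hs (not_le.1 h1)
    refine ⟨⟨⟨s', mem_halfPiece_iff.2 ⟨hs'.1, h3, h4⟩⟩, mem_halfPieceSeams_iff.2 hs'⟩, ?_⟩
    have e1 := h5 _ hx1
    have e2 := h5 _ hy1
    rw [dist_comm _ y.1, dist_comm s y.1]
    linarith

end UpperHalfPlane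

/-! ### Distance and topology of the quotient -/

section quotient

open UpperHalfPlane

lemma toPSL_eq_one_smul {g : SL(2, ℝ)} (hg : toPSL g = 1) (z : ℍ) : g • z = z := by
  have hc : g ∈ Subgroup.center SL(2, ℝ) := (QuotientGroup.eq_one_iff g).1 hg
  obtain ⟨r, hr, h⟩ := Matrix.SpecialLinearGroup.mem_center_iff.1 hc
  have hr2 : r = 1 ∨ r = -1 := by
    simpa using hr
  rcases hr2 with rfl | rfl
  · have : g = 1 := by ext i j; rw [← h]; simp
    rw [this, one_smul]
  · have : g = -1 := by
      ext i j; rw [← h]; simp [Matrix.diagonal_apply, Matrix.one_apply]; split_ifs <;> simp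
    rw [this]
    ext
    rw [coe_specialLinearGroup_apply]
    simp

lemma toPSL_mul (g h : SL(2, ℝ)) : toPSL (g * h) = toPSL g * toPSL h := rfl

lemma toPSL_inv (g : SL(2, ℝ)) : toPSL g⁻¹ = (toPSL g)⁻¹ := rfl

lemma toPSL_eq_smul {g h : SL(2, ℝ)} (hg : toPSL g = toPSL h) (z : ℍ) : g • z = h • z := by
  have h1 : toPSL (h⁻¹ * g) = 1 := by rw [toPSL_mul, toPSL_inv, hg, inv_mul_cancel]
  have := toPSL_eq_one_smul h1 z
  rw [mul_smul] at this
  exact inv_smul_eq_iff.1 this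

variable {G : Subgroup PSL(2, ℝ)}

namespace HypQuotient

lemma proj_eq_iff {z w : ℍ} : proj G z = proj G w ↔ ∃ g ∈ liftSL G, g • w = z := by
  unfold proj
  rw [Quotient.eq, MulAction.orbitRel_apply, MulAction.mem_orbit_iff]
  constructor
  · rintro ⟨g, hg⟩; exact ⟨g, g.2, hg⟩
  · rintro ⟨g, hg, h⟩; exact ⟨⟨g, hg⟩, h⟩

lemma proj_surjective : Function.Surjective (proj G) := Quotient.mk_surjective

lemma hdist_proj_le (z w : ℍ) : hdist (proj G z) (proj G w) ≤ dist z w := by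
  refine csInf_le ⟨0, ?_⟩ ⟨z, w, rfl, rfl, rfl⟩
  rintro r ⟨z', w', -, -, rfl⟩
  exact dist_nonneg

/-- The group acts by isometries, so it suffices to move one of the two points. -/
lemma le_hdist_proj {D : ℝ} {z w : ℍ} (h : ∀ g ∈ liftSL G, D ≤ dist z (g • w)) :
    D ≤ hdist (proj G z) (proj G w) := by
  refine le_csInf ⟨_, z, w, rfl, rfl, rfl⟩ ?_
  rintro r ⟨z', w', hz, hw, rfl⟩
  obtain ⟨g, hg, rfl⟩ := proj_eq_iff.1 hz
  obtain ⟨k, hk, rfl⟩ := proj_eq_iff.1 hw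
  have := h (g⁻¹ * k) (mul_mem (inv_mem hg) hk)
  rwa [mul_smul, ← dist_smul g z, smul_inv_smul] at this

lemma exists_of_hdist_lt {ε : ℝ} {z : ℍ} {q : HypQuotient G} (h : hdist (proj G z) q < ε) :
    ∃ w, proj G w = q ∧ dist z w < ε := by
  obtain ⟨q, rfl⟩ := proj_surjective q
  by_contra! hc
  refine not_le.2 h (le_hdist_proj fun g hg => hc _ ?_)
  exact proj_eq_iff.2 ⟨g, hg, rfl⟩

lemma hdist_comm (p q : HypQuotient G) : hdist p q = hdist q p := by
  unfold hdist
  congr 1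
  ext r
  constructor <;> rintro ⟨z, w, h1, h2, h3⟩ <;> exact ⟨w, z, h2, h1, by rw [h3, dist_comm]⟩

lemma hdist_self (p : HypQuotient G) : hdist p p = 0 := by
  obtain ⟨z, rfl⟩ := proj_surjective p
  refine le_antisymm ((hdist_proj_le z z).trans (dist_self z).le) ?_
  exact le_hdist_proj fun g _ => dist_nonneg

/-- The preimage in `ℍ` is a union of translates of a ball. With `exists_ball_subset` this shows
that the `hdist` balls form a basis of the quotient topology. -/
lemma isOpen_setOf_hdist_lt (p : HypQuotient G) (ε : ℝ) : IsOpen {q | hdist p q < ε} := by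
  obtain ⟨z, rfl⟩ := proj_surjective p
  have : IsOpen (proj G ⁻¹' {q | hdist (proj G z) q < ε}) := by
    have e : proj G ⁻¹' {q | hdist (proj G z) q < ε} =
        ⋃ g : liftSL G, (fun w : ℍ => (g : SL(2, ℝ)) • w) ⁻¹' Metric.ball z ε := by
      ext w
      simp only [Set.mem_preimage, Set.mem_ofPred_eq, Set.mem_iUnion, Metric.mem_ball]
      constructor
      · intro h
        obtain ⟨w', hw', hd⟩ := exists_of_hdist_lt h
        obtain ⟨g, hg, rfl⟩ := proj_eq_iff.1 hw'
        exact ⟨⟨g, hg⟩, by rwa [dist_comm]⟩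
      · rintro ⟨g, hg⟩
        refine lt_of_le_of_lt ?_ hg
        have e : proj G w = proj G ((g : SL(2, ℝ)) • w) :=
          (proj_eq_iff.2 ⟨g.1, g.2, rfl⟩).symm
        rw [dist_comm, e]
        exact hdist_proj_le _ _
    rw [e]
    exact isOpen_iUnion fun g =>
      Metric.isOpen_ball.preimage (isometry_smul ℍ (g : SL(2, ℝ))).continuous
  exact this

lemma exists_ball_subset {U : Set (HypQuotient G)} (hU : IsOpen U) {p : HypQuotient G}
    (hp : p ∈ U) : ∃ ε > 0, ∀ q, hdist p q < ε → q ∈ U := by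
  obtain ⟨z, rfl⟩ := proj_surjective p
  have h : IsOpen (proj G ⁻¹' U) := hU.preimage continuous_quotient_mk'
  obtain ⟨ε, hε, hb⟩ := Metric.isOpen_iff.1 h z hp
  refine ⟨ε, hε, fun q hq => ?_⟩
  obtain ⟨w, rfl, hd⟩ := exists_of_hdist_lt hq
  exact hb (by rwa [Metric.mem_ball, dist_comm])

variable {Y : Type} [MetricSpace Y]

lemma continuous_of_hdist_le {f : Y → HypQuotient G}
    (h : ∀ a b, hdist (f a) (f b) ≤ dist a b) : Continuous f := by
  refine continuous_def.2 fun U hU => Metric.isOpen_iff.2 fun a ha => ?_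
  obtain ⟨ε, hε, hb⟩ := exists_ball_subset hU ha
  refine ⟨ε, hε, fun b hb' => hb _ ((h a b).trans_lt ?_)⟩
  rwa [dist_comm]

lemma isEmbedding_of_hdist_eq {f : Y → HypQuotient G}
    (h : ∀ a b, hdist (f a) (f b) = dist a b) : Topology.IsEmbedding f := by
  refine ⟨⟨le_antisymm ?_ ?_⟩, fun a b hab => ?_⟩
  · exact continuous_iff_le_induced.1 (continuous_of_hdist_le fun a b => (h a b).le)
  · refine fun U hU => isOpen_induced_iff.2
      ⟨⋃ a : Y, ⋃ ε : {ε : ℝ // Metric.ball a ε ⊆ U}, {q | hdist (f a) q < ε}, ?_, ?_⟩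
    · exact isOpen_iUnion fun a => isOpen_iUnion fun ε => isOpen_setOf_hdist_lt _ _
    · ext b
      simp only [Set.mem_preimage, Set.mem_iUnion, Set.mem_ofPred_eq]
      constructor
      · rintro ⟨a, ⟨ε, hε⟩, hd⟩
        exact hε (by rwa [Metric.mem_ball, dist_comm, ← h])
      · intro hb
        obtain ⟨ε, hε, hb'⟩ := Metric.isOpen_iff.1 hU b hb
        exact ⟨b, ⟨ε, hb'⟩, by rw [hdist_self]; exact hε⟩
  · have := h a b
    rw [hab, hdist_self] at this
    exact dist_eq_zero.1 this.symm

end HypQuotient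

end quotient

/-! ### The metric of the glued piece -/

section glue

open UpperHalfPlane

variable {α β : ℝ≥0}

namespace GluedPiece

/-- The first copy of the half piece. -/
noncomputable abbrev inL (p : halfPiece α β) : GluedPiece α β :=
  Metric.toGlueL isometry_subtype_coe isometry_subtype_coe p

/-- The second copy of the half piece. -/
noncomputable abbrev inR (p : halfPiece α β) : GluedPiece α β :=
  Metric.toGlueR isometry_subtype_coe isometry_subtype_coe p

lemma dist_inL (p q : halfPiece α β) : dist (inL p) (inL q) = dist p.1 q.1 := rfl

lemma dist_inR (p q : halfPiece α β) : dist (inR p) (inR q) = dist p.1 q.1 := rfl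

/-- The summand `0` is the gluing parameter `ε` of `Metric.glueDist`. -/
lemma dist_inL_inR (p q : halfPiece α β) : dist (inL p) (inR q) =
    (⨅ s : halfPieceSeams α β, dist p s.1 + dist q s.1) + 0 := rfl

lemma dist_inL_inR_le (p q : halfPiece α β) (s : halfPieceSeams α β) :
    dist (inL p) (inR q) ≤ dist p.1 s.1.1 + dist s.1.1 q.1 := by
  rw [dist_inL_inR, add_zero, dist_comm s.1.1]
  exact ciInf_le (f := fun s : halfPieceSeams α β => dist p s.1 + dist q s.1)
    ⟨0, by rintro _ ⟨s, rfl⟩; positivity⟩ s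

lemma le_dist_inL_inR {p q : halfPiece α β} {D : ℝ}
    (h : ∀ s : halfPieceSeams α β, D ≤ dist p.1 s.1.1 + dist s.1.1 q.1) :
    D ≤ dist (inL p) (inR q) := by
  rw [dist_inL_inR, add_zero]
  refine le_ciInf fun s => ?_
  rw [dist_comm q]
  exact h s

lemma dist_le_dist_inL_inR (p q : halfPiece α β) : dist p.1 q.1 ≤ dist (inL p) (inR q) :=
  le_dist_inL_inR fun _ => dist_triangle _ _ _

lemma exists_rep (y : GluedPiece α β) : (∃ p, y = inL p) ∨ ∃ p, y = inR p := by
  induction y using Quotient.inductionOn' with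
  | h a => cases a with
    | inl p => exact Or.inl ⟨p, rfl⟩
    | inr p => exact Or.inr ⟨p, rfl⟩

lemma inL_eq_inR (s : halfPieceSeams α β) : inL s.1 = inR s.1 :=
  congr_fun (Metric.toGlue_commute (Φ := ((↑) : halfPieceSeams α β → halfPiece α β))
    (Ψ := ((↑) : halfPieceSeams α β → halfPiece α β)) isometry_subtype_coe
    isometry_subtype_coe) s

lemma isClosed_seams : IsClosed (halfPieceSeams α β) := by
  have hre : Continuous fun p : halfPiece α β => p.1.re :=
    UpperHalfPlane.continuous_re.comp continuous_subtype_val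
  have him : Continuous fun p : halfPiece α β => p.1.im :=
    UpperHalfPlane.continuous_im.comp continuous_subtype_val
  exact (isClosed_eq hre continuous_const).union ((isClosed_eq hre continuous_const).union
    (isClosed_eq ((hre.pow 2).add (him.pow 2)) continuous_const))

/-- Distance zero only says that seam points come arbitrarily close to `p`; closedness of the seams
puts `p` on one. -/
lemma mem_seams_of_inL_eq_inR {p q : halfPiece α β} (h : inL p = inR q) :
    p = q ∧ p ∈ halfPieceSeams α β := by
  have h0 : dist (inL p) (inR q) = 0 := by rw [h, dist_self]
  have hpq : p = q := Subtype.ext (dist_le_zero.1 ((dist_le_dist_inL_inR p q).trans h0.le))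
  subst hpq
  refine ⟨rfl, ?_⟩
  rw [← isClosed_seams.closure_eq, Metric.mem_closure_iff]
  intro ε hε
  by_contra! hc
  have : ε ≤ dist (inL p) (inR p) := le_dist_inL_inR fun s => by
    have := hc s.1 s.2
    rw [Subtype.dist_eq] at this
    linarith [dist_nonneg (x := s.1.1) (y := p.1)]
  linarith

end GluedPiece

end glue

/-! ### The map from the glued piece to the quotient -/

open UpperHalfPlane HypQuotient GluedPiece

/-- The subgroup of `PSL(2, ℝ)` generated by the classes of two matrices. -/
abbrev pairGroup (A B : SL(2, ℝ)) : Subgroup PSL(2, ℝ) := Subgroup.closure {toPSL A, toPSL B}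

/-- `φ` is an isometry of `ℍ` conjugating `Tu` and `Tv` to the products of the reflection in the
unit circle with the reflections in `Re z = α` and `Re z = -β`. -/
structure IsPieceChart (Tu Tv : SL(2, ℝ)) (α β : ℝ) (φ : ℍ → ℍ) : Prop where
  isom : ∀ x y, dist (φ x) (φ y) = dist x y
  surj : Function.Surjective φ
  smul_u : ∀ w, Tu • φ w = φ (reflLine α (reflUnit w))
  smul_v : ∀ w, Tv • φ w = φ (reflLine (-β) (reflUnit w))

namespace IsPieceChart

/-- Invariance under the two generators passes to the whole group. It is used to confine group
orbits to explicitly described sets `S`. -/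
lemma mem_iff_of_smul {Tu Tv : SL(2, ℝ)} {α β : ℝ} {φ : ℍ → ℍ} (h : IsPieceChart Tu Tv α β φ)
    {S : Set ℍ} (hA : ∀ w, w ∈ S ↔ reflLine α (reflUnit w) ∈ S)
    (hB : ∀ w, w ∈ S ↔ reflLine (-β) (reflUnit w) ∈ S) {g : SL(2, ℝ)}
    (hg : g ∈ liftSL (pairGroup Tu Tv)) {z z' : ℍ} (hz : φ z' = g • φ z) : z ∈ S ↔ z' ∈ S := by
  have inj : ∀ {a b}, φ a = φ b → a = b := fun {a b} hab => by
    have := h.isom a b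
    rw [hab, dist_self] at this
    exact dist_eq_zero.1 this.symm
  have key : ∀ x ∈ pairGroup Tu Tv, ∀ g : SL(2, ℝ), toPSL g = x → ∀ z z', φ z' = g • φ z →
      (z ∈ S ↔ z' ∈ S) := by
    intro x hx
    induction hx using Subgroup.closure_induction with
    | mem x hx =>
      intro g hg z z' hz
      rcases hx with rfl | rfl
      · rw [toPSL_eq_smul hg, h.smul_u] at hz
        rw [inj hz]; exact hA z
      · rw [toPSL_eq_smul hg, h.smul_v] at hz
        rw [inj hz]; exact hB z
    | one =>
      intro g hg z z' hz
      rw [toPSL_eq_one_smul hg] at hz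
      rw [inj hz]
    | mul x y _ _ hx hy =>
      intro g hg z z' hz
      obtain ⟨k, rfl⟩ : ∃ k, toPSL k = y := QuotientGroup.mk_surjective y
      obtain ⟨w, hw⟩ := h.surj (k • φ z)
      rw [hy k rfl z w hw]
      refine hx (g * k⁻¹) (by rw [toPSL_mul, toPSL_inv, hg]; group) w z' ?_
      rw [hw, hz, mul_smul, inv_smul_smul]
    | inv x _ hx =>
      intro g hg z z' hz
      refine (hx g⁻¹ (by rw [toPSL_inv, hg, inv_inv]) z' z ?_).symm
      rw [hz, inv_smul_smul]
  exact key _ hg g rfl z z' hz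

variable {Tu Tv : SL(2, ℝ)} {α β : ℝ≥0} {φ : ℍ → ℍ}

/-- The reflections in the unit circle and in `Re z = α` differ by `Tu`, so they agree in the
quotient; likewise the third by `Tv`. On the second copy any of the three may be used. -/
lemma proj_reflUnit (h : IsPieceChart Tu Tv α β φ) (w : ℍ) :
    proj (pairGroup Tu Tv) (φ (reflLine α w)) = proj (pairGroup Tu Tv) (φ (reflUnit w)) := by
  refine proj_eq_iff.2 ⟨Tu, Subgroup.subset_closure (Or.inl rfl), ?_⟩
  rw [h.smul_u, isMirror_reflUnit.invol]

lemma proj_reflLine (h : IsPieceChart Tu Tv α β φ) (w : ℍ) :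
    proj (pairGroup Tu Tv) (φ (reflLine (-β) w)) =
      proj (pairGroup Tu Tv) (φ (reflLine α w)) := by
  rw [h.proj_reflUnit]
  refine proj_eq_iff.2 ⟨Tv, Subgroup.subset_closure (Or.inr rfl), ?_⟩
  rw [h.smul_v, isMirror_reflUnit.invol]

lemma mem_iff_of_proj_eq (h : IsPieceChart Tu Tv α β φ)
    {S : Set ℍ} (hA : ∀ w, w ∈ S ↔ reflLine α (reflUnit w) ∈ S)
    (hB : ∀ w, w ∈ S ↔ reflLine (-β) (reflUnit w) ∈ S) {z z' : ℍ}
    (hz : proj (pairGroup Tu Tv) (φ z') = proj (pairGroup Tu Tv) (φ z)) : z ∈ S ↔ z' ∈ S := by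
  obtain ⟨g, hg, h'⟩ := proj_eq_iff.1 hz
  exact h.mem_iff_of_smul hA hB hg h'.symm

/-- The reflections descend to an involution of the quotient; it exchanges the images of the two
copies. -/
lemma proj_reflLine_congr (h : IsPieceChart Tu Tv α β φ) {z w : ℍ}
    (hz : proj (pairGroup Tu Tv) (φ z) = proj (pairGroup Tu Tv) (φ w)) :
    proj (pairGroup Tu Tv) (φ (reflLine α z)) = proj (pairGroup Tu Tv) (φ (reflLine α w)) := by
  have := h.mem_iff_of_proj_eq (S := {z | proj (pairGroup Tu Tv) (φ (reflLine α z)) =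
    proj (pairGroup Tu Tv) (φ (reflLine α w))}) (fun z => ?_) (fun z => ?_) hz
  · exact this.1 rfl
  · simp only [Set.mem_ofPred_eq]
    rw [(isMirror_reflLine _).invol, h.proj_reflUnit z]
  · simp only [Set.mem_ofPred_eq]
    rw [← h.proj_reflLine (reflLine (-β) _), (isMirror_reflLine _).invol, h.proj_reflUnit z]

lemma le_hdist (h : IsPieceChart Tu Tv α β φ) {D : ℝ} {x w : ℍ}
    (hD : ∀ z, proj (pairGroup Tu Tv) (φ z) = proj (pairGroup Tu Tv) (φ w) → D ≤ dist x z) :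
    D ≤ hdist (proj (pairGroup Tu Tv) (φ x)) (proj (pairGroup Tu Tv) (φ w)) := by
  refine le_hdist_proj fun g hg => ?_
  obtain ⟨z, hz⟩ := h.surj (g • φ w)
  rw [← hz, h.isom]
  exact hD z (proj_eq_iff.2 ⟨g, hg, hz.symm⟩)

lemma hdist_le (h : IsPieceChart Tu Tv α β φ) (x w : ℍ) :
    hdist (proj (pairGroup Tu Tv) (φ x)) (proj (pairGroup Tu Tv) (φ w)) ≤ dist x w := by
  rw [← h.isom]
  exact hdist_proj_le _ _

/-- The image of a point of a seam does not depend on the copy of the half piece. -/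
lemma proj_reflLine_seam (h : IsPieceChart Tu Tv α β φ) {s : ℍ}
    (hs : s.re = α ∨ s.re = -(β : ℝ) ∨ s.absSq = 1) :
    proj (pairGroup Tu Tv) (φ (reflLine α s)) = proj (pairGroup Tu Tv) (φ s) := by
  rcases hs with hs | hs | hs
  · rw [(isMirror_reflLine _).fix s (by simp [hs])]
  · rw [← h.proj_reflLine, (isMirror_reflLine _).fix s (by simp [hs])]
  · rw [h.proj_reflUnit, isMirror_reflUnit.fix s (by simp [hs])]

/-- The map of the glued piece to the quotient. -/
lemma exists_pieceMap (h : IsPieceChart Tu Tv α β φ) :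
    ∃ f : GluedPiece α β → HypQuotient (pairGroup Tu Tv),
      (∀ p, f (inL p) = proj (pairGroup Tu Tv) (φ p.1)) ∧
      ∀ p, f (inR p) = proj (pairGroup Tu Tv) (φ (reflLine α p.1)) := by
  classical
  have hrep : ∀ y : GluedPiece α β, ∃ q : HypQuotient (pairGroup Tu Tv),
      (∀ p, y = inL p → q = proj (pairGroup Tu Tv) (φ p.1)) ∧
      ∀ p, y = inR p → q = proj (pairGroup Tu Tv) (φ (reflLine α p.1)) := by
    intro y
    rcases exists_rep y with ⟨p, rfl⟩ | ⟨p, rfl⟩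
    · refine ⟨proj (pairGroup Tu Tv) (φ p.1), fun p' hp => ?_, fun p' hp => ?_⟩
      · rw [(Metric.toGlueL_isometry _ _).injective hp]
      · obtain ⟨rfl, hs⟩ := mem_seams_of_inL_eq_inR hp
        exact (h.proj_reflLine_seam hs).symm
    · refine ⟨proj (pairGroup Tu Tv) (φ (reflLine α p.1)), fun p' hp => ?_, fun p' hp => ?_⟩
      · obtain ⟨rfl, hs⟩ := mem_seams_of_inL_eq_inR hp.symm
        exact h.proj_reflLine_seam hs
      · rw [(Metric.toGlueR_isometry _ _).injective hp]
  choose f hf using hrep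
  exact ⟨f, fun p => (hf _).1 p rfl, fun p => (hf _).2 p rfl⟩

lemma hdist_pieceMap_le (h : IsPieceChart Tu Tv α β φ)
    {f : GluedPiece α β → HypQuotient (pairGroup Tu Tv)}
    (hL : ∀ p, f (inL p) = proj (pairGroup Tu Tv) (φ p.1))
    (hR : ∀ p, f (inR p) = proj (pairGroup Tu Tv) (φ (reflLine α p.1)))
    (a b : GluedPiece α β) : hdist (f a) (f b) ≤ dist a b := by
  have hLR : ∀ p q, hdist (f (inL p)) (f (inR q)) ≤ dist (inL p) (inR q) := fun p q => by
    refine le_dist_inL_inR fun s => ?_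
    -- For a path through the seam point `s`, represent the second copy by the reflection that fixes
    -- `s`.
    have hd : ∀ r g, IsMirror r g → r s.1.1 = s.1.1 →
        proj (pairGroup Tu Tv) (φ (reflLine α q.1)) = proj (pairGroup Tu Tv) (φ (r q.1)) →
        hdist (f (inL p)) (f (inR q)) ≤ dist p.1 s.1.1 + dist s.1.1 q.1 := fun r g hr hs hq => by
      rw [hL, hR, hq]
      refine (h.hdist_le _ _).trans ((dist_triangle _ s.1.1 _).trans ?_)
      rw [← hr.dist_comm, hs]
    rcases s.2 with hs | hs | hs
    · exact hd _ _ (isMirror_reflLine α) ((isMirror_reflLine _).fix _ (by simp [hs])) rfl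
    · exact hd _ _ (isMirror_reflLine (-β)) ((isMirror_reflLine _).fix _ (by simp [hs]))
        (h.proj_reflLine _).symm
    · exact hd _ _ isMirror_reflUnit (isMirror_reflUnit.fix _ (by simp [absSq, hs]))
        (h.proj_reflUnit _)
  rcases exists_rep a with ⟨p, rfl⟩ | ⟨p, rfl⟩ <;> rcases exists_rep b with ⟨q, rfl⟩ | ⟨q, rfl⟩
  · rw [hL, hL]; exact h.hdist_le _ _
  · exact hLR p q
  · rw [hdist_comm, dist_comm]; exact hLR q p
  · rw [hR, hR, dist_inR, ← (isMirror_reflLine (α : ℝ)).isom]; exact h.hdist_le _ _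

lemma dist_le_hdist_pieceMap (h : IsPieceChart Tu Tv α β φ)
    (hC : IsChamber {reflUnit, reflLine α, reflLine (-β)} (idealChamber α β) (idealWalls α β))
    {f : GluedPiece α β → HypQuotient (pairGroup Tu Tv)}
    (hL : ∀ p, f (inL p) = proj (pairGroup Tu Tv) (φ p.1))
    (hR : ∀ p, f (inR p) = proj (pairGroup Tu Tv) (φ (reflLine α p.1)))
    (a b : GluedPiece α β) : dist a b ≤ hdist (f a) (f b) := by
  -- Both generators are products of two reflections, so the group preserves the parity of an orbit.
  have horb : ∀ O : Bool → Set ℍ,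
      (∀ r ∈ ({reflUnit, reflLine α, reflLine (-β)} : Set (ℍ → ℍ)), ∀ b, ∀ z ∈ O b,
        r z ∈ O (!b)) → ∀ b z z',
      proj (pairGroup Tu Tv) (φ z') = proj (pairGroup Tu Tv) (φ z) → z ∈ O b → z' ∈ O b := by
    intro O hO b z z' hz
    have key : ∀ r ∈ ({reflUnit, reflLine α, reflLine (-β)} : Set (ℍ → ℍ)), (∀ x, r (r x) = x) →
        ∀ w, w ∈ O b ↔ r (reflUnit w) ∈ O b := fun r hr hi w => by
      constructor
      · intro hw
        simpa using hO r hr _ _ (hO reflUnit (by simp) _ _ hw)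
      · intro hw
        have := hO reflUnit (by simp) _ _ (hO r hr _ _ hw)
        simpa [hi, isMirror_reflUnit.invol] using this
    exact (h.mem_iff_of_proj_eq (S := O b)
      (key _ (by simp) (isMirror_reflLine _).invol)
      (key _ (by simp) (isMirror_reflLine _).invol) hz).1
  have hch : ∀ p : halfPiece α β, p.1 ∈ idealChamber α β := fun p => (mem_halfPiece_iff.1 p.2).1
  have hLL : ∀ p q : halfPiece α β, ∀ z,
      proj (pairGroup Tu Tv) (φ z) = proj (pairGroup Tu Tv) (φ q.1) →
      dist p.1 q.1 ≤ dist p.1 z := fun p q z hz => by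
    obtain ⟨O, h1, h2, h3, -⟩ := hC q.1 (hch q)
    exact h3 _ (hch p) z (horb O h2 _ _ _ hz h1)
  have hLR : ∀ p q, dist (inL p) (inR q) ≤ hdist (f (inL p)) (f (inR q)) := fun p q => by
    rw [hL, hR]
    refine h.le_hdist fun z hz => ?_
    obtain ⟨O, h1, h2, -, h4⟩ := hC q.1 (hch q)
    obtain ⟨s, hs, hd⟩ := h4 _ (hch p) z
      (horb O h2 _ _ _ hz (h2 (reflLine α) (by simp) _ _ h1))
    obtain ⟨s', hs'⟩ := exists_seam p q hs
    exact ((dist_inL_inR_le p q s').trans hs').trans hd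
  rcases exists_rep a with ⟨p, rfl⟩ | ⟨p, rfl⟩ <;> rcases exists_rep b with ⟨q, rfl⟩ | ⟨q, rfl⟩
  · rw [hL, hL]; exact h.le_hdist (hLL p q)
  · exact hLR p q
  · rw [hdist_comm, dist_comm]; exact hLR q p
  · rw [hR, hR, dist_inR]
    refine h.le_hdist fun z hz => ?_
    rw [(isMirror_reflLine _).dist_comm]
    refine hLL p q _ ?_
    have := h.proj_reflLine_congr hz
    rwa [(isMirror_reflLine _).invol] at this

/-- A local substitute for the chamber property: `hinj` is an injectivity radius at `p₀`. Away from
the vertex at most one mirror matters near `p₀`, so a single folding is enough. -/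
lemma isLocallyIsometricAt (h : IsPieceChart Tu Tv α β φ) (hβ : 1 ≤ β)
    {f : GluedPiece α β → HypQuotient (pairGroup Tu Tv)}
    (hL : ∀ p, f (inL p) = proj (pairGroup Tu Tv) (φ p.1))
    (hR : ∀ p, f (inR p) = proj (pairGroup Tu Tv) (φ (reflLine α p.1)))
    {p₀ : halfPiece α β} (hv : ¬ (p₀.1.re = α ∧ p₀.1.absSq = 1)) {δ : ℝ} (hδ : 0 < δ)
    (hinj : ∀ x y z : ℍ, dist x p₀.1 < δ → dist y p₀.1 < δ →
      proj (pairGroup Tu Tv) (φ z) = proj (pairGroup Tu Tv) (φ y) → dist x y ≤ dist x z)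
    {y : GluedPiece α β} (hy : y = inL p₀ ∨ y = inR p₀) : IsLocallyIsometricAt f y := by
  have hβ' : (1 : ℝ) ≤ β := by exact_mod_cast hβ
  have hLL : ∀ p q : halfPiece α β, dist p.1 p₀.1 < δ → dist q.1 p₀.1 < δ →
      dist (inL p) (inL q) ≤ hdist (f (inL p)) (f (inL q)) := fun p q hp hq => by
    rw [hL, hL]; exact h.le_hdist fun z hz => hinj _ _ z hp hq hz
  have hRR : ∀ p q : halfPiece α β, dist p.1 p₀.1 < δ → dist q.1 p₀.1 < δ →
      dist (inR p) (inR q) ≤ hdist (f (inR p)) (f (inR q)) := fun p q hp hq => by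
    rw [hR, hR, dist_inR]
    refine h.le_hdist fun z hz => ?_
    rw [(isMirror_reflLine _).dist_comm]
    refine hinj _ _ _ hp hq ?_
    have := h.proj_reflLine_congr hz
    rwa [(isMirror_reflLine _).invol] at this
  by_cases hs : p₀ ∈ halfPieceSeams α β
  · have hyL : y = inL p₀ := by
      rcases hy with hy | hy
      · exact hy
      · rw [hy]; exact (inL_eq_inR ⟨p₀, hs⟩).symm
    have hyR : y = inR p₀ := by rw [hyL]; exact inL_eq_inR ⟨p₀, hs⟩
    -- `r` is the reflection in the seam through `p₀`. As `p₀` is not the vertex, its mirror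
    -- consists of wall points near `p₀`.
    obtain ⟨r, g, hr, hfix, hproj, hpos, hev⟩ : ∃ r g, IsMirror r g ∧ r p₀.1 = p₀.1 ∧
        (∀ w, proj (pairGroup Tu Tv) (φ (reflLine α w)) = proj (pairGroup Tu Tv) (φ (r w))) ∧
        (∀ x : halfPiece α β, 0 ≤ g x.1) ∧
        ∀ᶠ s in 𝓝 p₀.1, g s = 0 → s ∈ idealWalls α β := by
      obtain ⟨⟨h1, h2, h3⟩, -, -⟩ := mem_halfPiece_iff.1 p₀.2
      have hre : Continuous fun z : ℍ => z.re := UpperHalfPlane.continuous_re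
      have hab : Continuous fun z : ℍ => z.absSq :=
        (UpperHalfPlane.continuous_re.pow 2).add (UpperHalfPlane.continuous_im.pow 2)
      have hlt := sq_re_lt_absSq p₀.1
      have hα0 := α.coe_nonneg
      rcases hs with hs | hs | hs
      · refine ⟨_, _, isMirror_reflLine α, (isMirror_reflLine _).fix _ (by simp [hs]),
          fun w => rfl, fun x => ?_, ?_⟩
        · obtain ⟨⟨h1, h2, h3⟩, -, -⟩ := mem_halfPiece_iff.1 x.2
          linarith
        · have h4 : 1 < p₀.1.absSq := lt_of_le_of_ne h3 fun he => hv ⟨hs, he.symm⟩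
          filter_upwards [continuous_const.continuousAt.eventually_lt hab.continuousAt h4]
            with s hs1 hs2
          exact ⟨⟨by linarith, by linarith, hs1.le⟩, Or.inl (by linarith)⟩
      · refine ⟨_, _, (isMirror_reflLine (-β)).neg, (isMirror_reflLine _).fix _ (by simp [hs]),
          fun w => (h.proj_reflLine w).symm, fun x => ?_, ?_⟩
        · obtain ⟨⟨h1, h2, h3⟩, -, -⟩ := mem_halfPiece_iff.1 x.2
          linarith
        · filter_upwards with s hs2
          have := sq_re_lt_absSq s
          have hs3 : s.re = -β := by linarith
          exact ⟨⟨by linarith, by linarith, by nlinarith⟩, Or.inr (Or.inl hs3)⟩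
      · have hs' : p₀.1.absSq = 1 := hs
        refine ⟨_, _, isMirror_reflUnit, isMirror_reflUnit.fix _ (by simp [hs']),
          fun w => h.proj_reflUnit w, fun x => ?_, ?_⟩
        · obtain ⟨⟨h1, h2, h3⟩, -, -⟩ := mem_halfPiece_iff.1 x.2
          linarith
        · have h4 : p₀.1.re < α := lt_of_le_of_ne h2 fun he => hv ⟨he, hs'⟩
          filter_upwards [hre.continuousAt.eventually_lt continuous_const.continuousAt h4]
            with s hs1 hs2
          have := sq_re_lt_absSq s
          exact ⟨⟨by nlinarith, hs1.le, by linarith⟩, Or.inr (Or.inr (by linarith))⟩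
    obtain ⟨η, hη, hball⟩ := Metric.eventually_nhds_iff.1 hev
    -- The crossing point `s` is within `2ε` of `p`, hence within `3ε` of `p₀`.
    obtain ⟨ε, hε0, hεδ, hεη⟩ : ∃ ε > 0, ε ≤ δ ∧ 3 * ε ≤ η :=
      ⟨min δ (η / 3), by positivity, min_le_left _ _, by
        have := min_le_right δ (η / 3); linarith⟩
    have hLR : ∀ p q : halfPiece α β, dist p.1 p₀.1 < ε → dist q.1 p₀.1 < ε →
        dist (inL p) (inR q) ≤ hdist (f (inL p)) (f (inR q)) := fun p q hp hq => by
      rw [hL, hR]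
      refine h.le_hdist fun z hz => ?_
      rw [hproj] at hz
      have hrq : dist (r q.1) p₀.1 < ε := by rwa [hr.dist_comm, hfix]
      have hd := hinj p.1 _ z (hp.trans_le hεδ) (hrq.trans_le hεδ) hz
      obtain ⟨s, hs0, hsd, -⟩ := hr.exists_wall (hpos p) (hpos q)
      have hsb : dist s p₀.1 < η := by
        have e1 := dist_triangle s p.1 p₀.1
        have e2 := dist_triangle_right p.1 (r q.1) p₀.1
        rw [dist_comm s p.1] at e1
        linarith [dist_nonneg (x := s) (y := q.1)]
      obtain ⟨s', hs'⟩ := exists_seam p q (hball hsb hs0)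
      exact ((dist_inL_inR_le p q s').trans hs').trans (hsd.trans hd)
    refine ⟨Metric.ball y ε, Metric.ball_mem_nhds y hε0, fun a ha b hb => ?_⟩
    refine le_antisymm (h.hdist_pieceMap_le hL hR a b) ?_
    rw [Metric.mem_ball] at ha hb
    rcases exists_rep a with ⟨p, rfl⟩ | ⟨p, rfl⟩ <;>
      rcases exists_rep b with ⟨q, rfl⟩ | ⟨q, rfl⟩
    · rw [hyL, dist_inL] at ha hb
      exact hLL p q (ha.trans_le hεδ) (hb.trans_le hεδ)
    · rw [hyL, dist_inL] at ha
      rw [hyR, dist_inR] at hb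
      exact hLR p q ha hb
    · rw [hyR, dist_inR] at ha
      rw [hyL, dist_inL] at hb
      rw [hdist_comm, dist_comm]
      exact hLR q p hb ha
    · rw [hyR, dist_inR] at ha hb
      exact hRR p q (ha.trans_le hεδ) (hb.trans_le hεδ)
  · obtain ⟨η, hη, hball⟩ : ∃ η > 0, ∀ s ∈ halfPieceSeams α β, η ≤ dist p₀.1 s.1 := by
      have := isClosed_seams.isOpen_compl.mem_nhds hs
      obtain ⟨η, hη, hb⟩ := Metric.mem_nhds_iff.1 this
      refine ⟨η, hη, fun s hs' => ?_⟩
      by_contra! hc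
      exact hb (show s ∈ Metric.ball p₀ η by
        rwa [Metric.mem_ball, dist_comm, Subtype.dist_eq]) hs'
    have hfar : ∀ p, η ≤ dist (inR p) (inL p₀) ∧ η ≤ dist (inL p) (inR p₀) := fun p => by
      constructor
      · rw [dist_comm]
        refine le_dist_inL_inR fun s => ?_
        linarith [hball s.1 s.2, dist_nonneg (x := s.1.1) (y := p.1)]
      · refine le_dist_inL_inR fun s => ?_
        have := hball s.1 s.2
        rw [dist_comm] at this
        linarith [dist_nonneg (x := p.1) (y := s.1.1)]
    refine ⟨Metric.ball y (min δ η), Metric.ball_mem_nhds y (by positivity), fun a ha b hb => ?_⟩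
    refine le_antisymm (h.hdist_pieceMap_le hL hR a b) ?_
    rw [Metric.mem_ball, lt_min_iff] at ha hb
    rcases hy with rfl | rfl
    · rcases exists_rep a with ⟨p, rfl⟩ | ⟨p, rfl⟩
      · rcases exists_rep b with ⟨q, rfl⟩ | ⟨q, rfl⟩
        · exact hLL p q ha.1 hb.1
        · exact absurd hb.2 (not_lt.2 (hfar q).1)
      · exact absurd ha.2 (not_lt.2 (hfar p).1)
    · rcases exists_rep a with ⟨p, rfl⟩ | ⟨p, rfl⟩
      · exact absurd ha.2 (not_lt.2 (hfar p).2)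
      · rcases exists_rep b with ⟨q, rfl⟩ | ⟨q, rfl⟩
        · exact absurd hb.2 (not_lt.2 (hfar q).2)
        · exact hRR p q ha.1 hb.1

end IsPieceChart

/-! ### Elliptic elements of a discrete group -/

section elliptic

lemma Matrix.sq_eq_trace_smul_sub_one {g : Matrix (Fin 2) (Fin 2) ℝ} (hg : g.det = 1) :
    g * g = (g 0 0 + g 1 1) • g - 1 := by
  rw [Matrix.det_fin_two] at hg
  ext i j
  fin_cases i <;> fin_cases j <;>
    simp [Matrix.mul_apply, Fin.sum_univ_two] <;> linarith

/-- By Cayley–Hamilton the powers satisfy the Chebyshev recursion of `sin (nθ) / sin θ`. -/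
lemma Matrix.pow_eq_sin {g : Matrix (Fin 2) (Fin 2) ℝ} (hg : g.det = 1) {θ : ℝ}
    (hs : Real.sin θ ≠ 0) (ht : g 0 0 + g 1 1 = 2 * Real.cos θ) (n : ℕ) :
    g ^ n = (Real.sin (n * θ) / Real.sin θ) • g -
      (Real.sin (n * θ - θ) / Real.sin θ) • (1 : Matrix (Fin 2) (Fin 2) ℝ) := by
  induction n with
  | zero => simp [hs]
  | succ n ih =>
    have e : Real.sin ((n + 1 : ℕ) * θ) / Real.sin θ =
        2 * Real.cos θ * (Real.sin (n * θ) / Real.sin θ) -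
          Real.sin (n * θ - θ) / Real.sin θ := by
      rw [show ((n + 1 : ℕ) : ℝ) * θ = n * θ + θ by push_cast; ring, Real.sin_add, Real.sin_sub]
      field_simp
      ring
    have e2 : ((n + 1 : ℕ) : ℝ) * θ - θ = n * θ := by push_cast; ring
    rw [pow_succ, ih, e, e2, sub_mul, smul_mul_assoc, smul_mul_assoc, one_mul,
      Matrix.sq_eq_trace_smul_sub_one hg, ht]
    module

/-- Elliptic elements of a Fuchsian group have finite order. -/
lemma IsFuchsian.exists_pow_smul_eq {Γ : Subgroup PSL(2, ℝ)} (hΓ : IsFuchsian Γ) {g : SL(2, ℝ)}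
    (hg : toPSL g ∈ Γ) (ht : |g 0 0 + g 1 1| < 2) :
    ∃ N : ℕ, 0 < N ∧ ∀ z : ℍ, g ^ N • z = z := by
  have hpi := Real.pi_pos
  obtain ⟨ht1, ht2⟩ := abs_lt.1 ht
  obtain ⟨θ, hθ⟩ : ∃ θ, θ = Real.arccos ((g 0 0 + g 1 1) / 2) := ⟨_, rfl⟩
  have hcos : g 0 0 + g 1 1 = 2 * Real.cos θ := by
    rw [hθ, Real.cos_arccos (by linarith) (by linarith)]; ring
  have hs : Real.sin θ ≠ 0 := by
    intro h
    have h2 := Real.sin_sq_add_cos_sq θ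
    rw [h] at h2
    nlinarith
  obtain ⟨O, hO, hO1⟩ : ∃ O : Set PSL(2, ℝ), IsOpen O ∧ ∀ x : Γ, (x : PSL(2, ℝ)) ∈ O ↔ x = 1 := by
    have : DiscreteTopology Γ := hΓ
    obtain ⟨O, hO, h⟩ := isOpen_induced_iff.1 (isOpen_discrete ({1} : Set Γ))
    exact ⟨O, hO, fun x => by rw [← Set.mem_singleton_iff, ← h]; rfl⟩
  have hcont : Continuous toPSL := continuous_quotient_mk'
  obtain ⟨U, hU, hUO⟩ := isOpen_induced_iff.1 (hO.preimage hcont)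
  have hmem : ∀ k : SL(2, ℝ), (k : Matrix (Fin 2) (Fin 2) ℝ) ∈ U ↔ toPSL k ∈ O := fun k =>
    iff_of_eq (congr_fun (congr_arg (fun S : Set SL(2, ℝ) => fun k => k ∈ S) hUO) k)
  -- `F` is the one-parameter group of rotations through `g`: it is `2π`-periodic and `F (kθ) = g ^
  -- k`. By Dirichlet approximation some `kθ` with `k > 0` is so close to `2πℤ` that `g ^ k` lies in
  -- the neighbourhood of the identity that isolates it in `Γ`.
  let F : ℝ → Matrix (Fin 2) (Fin 2) ℝ := fun x => (Real.sin x / Real.sin θ) • g.1 -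
      (Real.sin (x - θ) / Real.sin θ) • (1 : Matrix (Fin 2) (Fin 2) ℝ)
  have hF : Continuous F := by
    have h1 : Continuous fun x : ℝ => Real.sin x / Real.sin θ := by fun_prop
    have h2 : Continuous fun x : ℝ => Real.sin (x - θ) / Real.sin θ := by fun_prop
    exact (h1.smul continuous_const).sub (h2.smul continuous_const)
  have hF0 : F 0 ∈ U := by
    have : F 0 = ((1 : SL(2, ℝ)) : Matrix (Fin 2) (Fin 2) ℝ) := by simp [F, hs]
    rw [this, hmem]
    exact (hO1 1).2 rfl
  obtain ⟨ε, hε, hball⟩ := Metric.isOpen_iff.1 (hU.preimage hF) 0 hF0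
  obtain ⟨n, hn⟩ := exists_nat_gt (2 * Real.pi / ε)
  have hn0 : 0 < n := by
    have : (0 : ℝ) < n := lt_trans (by positivity) hn
    exact_mod_cast this
  obtain ⟨k, hk0, -, hk⟩ := Real.exists_nat_abs_mul_sub_round_le (θ / (2 * Real.pi)) hn0
  obtain ⟨m, hm⟩ : ∃ m, m = round (k * (θ / (2 * Real.pi))) := ⟨_, rfl⟩
  rw [← hm] at hk
  have hclose : |k * θ - m * (2 * Real.pi)| < ε := by
    have e : k * θ - m * (2 * Real.pi) = (k * (θ / (2 * Real.pi)) - m) * (2 * Real.pi) := by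
      field_simp
    rw [e, abs_mul, abs_of_pos (by positivity : 0 < 2 * Real.pi)]
    have h1 : 2 * Real.pi < n * ε := (div_lt_iff₀ hε).1 hn
    have h2 : |k * (θ / (2 * Real.pi)) - m| * (n + 1) ≤ 1 := (le_div_iff₀ (by positivity)).1 hk
    have h3 := abs_nonneg (k * (θ / (2 * Real.pi)) - m)
    by_contra! hc
    nlinarith
  have hFk : F (k * θ - m * (2 * Real.pi)) = ((g ^ k : SL(2, ℝ)) : Matrix (Fin 2) (Fin 2) ℝ) := by
    rw [Matrix.SpecialLinearGroup.coe_pow, Matrix.pow_eq_sin g.2 hs hcos]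
    simp only [F]
    rw [Real.sin_sub_int_mul_two_pi,
      show k * θ - m * (2 * Real.pi) - θ = k * θ - θ - m * (2 * Real.pi) by ring,
      Real.sin_sub_int_mul_two_pi]
  have hgU : toPSL (g ^ k) ∈ O := by
    rw [← hmem, ← hFk]
    exact hball (by rw [Metric.mem_ball, Real.dist_eq, sub_zero]; exact hclose)
  have hgk : toPSL (g ^ k) ∈ Γ := (liftSL Γ).pow_mem hg k
  have := (hO1 ⟨_, hgk⟩).1 hgU
  exact ⟨k, hk0, fun z => toPSL_eq_one_smul (congr_arg Subtype.val this) z⟩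

end elliptic

/-! ### Explicit estimates for Möbius transformations -/

namespace UpperHalfPlane

section moebius

variable (g : SL(2, ℝ)) (z : ℍ)

lemma det_eq_one_of_SL : g 0 0 * g 1 1 - g 0 1 * g 1 0 = 1 := by
  have := g.2
  rwa [Matrix.det_fin_two] at this

lemma im_smul_SL : (g • z).im = z.im / ((g 1 0 * z.re + g 1 1) ^ 2 + (g 1 0 * z.im) ^ 2) := by
  rw [← coe_im, coe_specialLinearGroup_apply, Complex.div_im]
  have h := det_eq_one_of_SL g
  simp [Complex.normSq_apply]
  rw [← sub_div]
  congr 1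
  · linear_combination z.im * h
  · ring

lemma re_smul_SL : (g • z).re = ((g 0 0 * z.re + g 0 1) * (g 1 0 * z.re + g 1 1) +
    g 0 0 * g 1 0 * z.im ^ 2) / ((g 1 0 * z.re + g 1 1) ^ 2 + (g 1 0 * z.im) ^ 2) := by
  rw [← coe_re, coe_specialLinearGroup_apply, Complex.div_re]
  simp [Complex.normSq_apply]
  rw [← add_div]
  congr 1 <;> ring

lemma denom_pos_SL : 0 < (g 1 0 * z.re + g 1 1) ^ 2 + (g 1 0 * z.im) ^ 2 := by
  have h := (g • z).im_pos
  rw [im_smul_SL] at h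
  by_contra! hc
  exact absurd h (not_lt.2 (div_nonpos_of_nonneg_of_nonpos z.im_pos.le hc))

variable {g z}

/-- At a fixed point the imaginary part forces `|c z + d| = 1`; the real part is then `(a - d) /
(2c)`, which leaves only one height. -/
lemma eq_of_smul_eq_of_ne {w : ℍ} (hc : g 1 0 ≠ 0) (hz : g • z = z) (hw : g • w = w) : z = w := by
  have key : ∀ v : ℍ, g • v = v → v.re = (g 0 0 - g 1 1) / (2 * g 1 0) ∧
      (g 1 0 * v.re + g 1 1) ^ 2 + (g 1 0 * v.im) ^ 2 = 1 := fun v hv => by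
    have hvi := v.im_pos
    have hD := denom_pos_SL g v
    have h1 := im_smul_SL g v
    have h2 := re_smul_SL g v
    rw [hv, eq_div_iff hD.ne'] at h1 h2
    have hD1 : (g 1 0 * v.re + g 1 1) ^ 2 + (g 1 0 * v.im) ^ 2 = 1 :=
      mul_left_cancel₀ hvi.ne' (by linarith)
    refine ⟨?_, hD1⟩
    rw [hD1, mul_one] at h2
    rw [eq_div_iff (by simpa using hc)]
    have h := det_eq_one_of_SL g
    linear_combination g 1 0 * h2 + g 0 0 * hD1 - (g 1 0 * v.re + g 1 1) * h
  obtain ⟨h1, h2⟩ := key z hz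
  obtain ⟨h3, h4⟩ := key w hw
  have hre : z.re = w.re := by rw [h1, h3]
  refine ext_re_im hre ?_
  rw [hre] at h2
  have h5 : z.im ^ 2 = w.im ^ 2 := by
    apply mul_left_cancel₀ (pow_ne_zero 2 hc)
    linear_combination h2 - h4
  exact (sq_eq_sq₀ z.im_pos.le w.im_pos.le).1 h5

lemma smul_eq_of_entry_eq_zero {p : ℍ} (hc : g 1 0 = 0) (hp : g • p = p) (z : ℍ) :
    g • z = z := by
  have h := det_eq_one_of_SL g
  have h1 := im_smul_SL g p
  have h2 := re_smul_SL g p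
  have hpi := p.im_pos
  have hd : g 1 1 ≠ 0 := by
    intro h0; rw [h0, hc] at h; simp at h
  rw [hp, hc] at h1 h2
  simp only [zero_mul, zero_add, mul_zero, add_zero, ne_eq, OfNat.ofNat_ne_zero,
    not_false_eq_true, zero_pow] at h1 h2
  rw [eq_div_iff (by positivity)] at h1 h2
  have hd2 : g 1 1 ^ 2 = 1 := mul_left_cancel₀ hpi.ne' (by linarith)
  rw [hc] at h
  have ha : g 0 0 = g 1 1 := mul_right_cancel₀ hd (by linarith)
  have hb : g 0 1 = 0 := by
    rw [hd2, ha] at h2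
    have : g 0 1 * g 1 1 = 0 := by linear_combination (-1 : ℝ) * h2 - p.re * hd2
    exact (mul_eq_zero.1 this).resolve_right hd
  apply ext_re_im
  · rw [re_smul_SL, hc, hb, ha]
    field_simp
    ring
  · rw [im_smul_SL, hc]
    simp [hd2]

/-- A Möbius transformation which moves `∞` maps points far from `Re z = α` to low points near
the image of `∞`. -/
lemma eventually_smul_low (hc : g 1 0 ≠ 0) (α : ℝ) {ε : ℝ} (hε : 0 < ε) :
    ∀ᶠ W in Filter.atTop, ∀ z : ℍ, W / 4 ≤ |z.re - α| →
      (g • z).im ≤ ε ∧ |(g • z).re - α| < W / 4 := by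
  have hc0 : 0 < |g 1 0| := abs_pos.2 hc
  -- `R` is a lower bound for `|c Re z + d|` far from `α`: `R |c| ≥ 1` keeps the image within `1` of
  -- `a / c`, and `R |c| ε ≥ 1` makes it low.
  obtain ⟨R, hR⟩ : ∃ R, R = 1 / |g 1 0| + 1 / (|g 1 0| * ε) := ⟨_, rfl⟩
  have hR0 : 0 < R := by rw [hR]; positivity
  have hRc : 1 ≤ R * |g 1 0| := by
    rw [hR, add_mul]
    have : 1 / |g 1 0| * |g 1 0| = 1 := by field_simp
    have : 0 ≤ 1 / (|g 1 0| * ε) * |g 1 0| := by positivity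
    linarith
  have hRε : 1 ≤ R * |g 1 0| * ε := by
    rw [hR]
    have : (1 / |g 1 0| + 1 / (|g 1 0| * ε)) * |g 1 0| * ε = ε + 1 := by field_simp
    linarith
  filter_upwards [Filter.eventually_ge_atTop (4 * ((R + |g 1 0 * α + g 1 1|) / |g 1 0|)),
    Filter.eventually_gt_atTop (4 * (|g 0 0 / g 1 0 - α| + 1))] with W hW1 hW2 z hz
  have hzi := z.im_pos
  have hD := denom_pos_SL g z
  obtain ⟨u, hu⟩ : ∃ u, u = g 1 0 * z.re + g 1 1 := ⟨_, rfl⟩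
  have huR : R ≤ |u| := by
    have h1 : |g 1 0| * |z.re - α| ≤ |u| + |g 1 0 * α + g 1 1| := by
      rw [← abs_mul, show g 1 0 * (z.re - α) = u - (g 1 0 * α + g 1 1) by rw [hu]; ring]
      exact abs_sub _ _
    have h2 : (R + |g 1 0 * α + g 1 1|) / |g 1 0| ≤ |z.re - α| := by linarith
    rw [div_le_iff₀ hc0] at h2
    linarith
  have hus : R * |u| ≤ u ^ 2 := by
    rw [← sq_abs u, sq]
    exact mul_le_mul_of_nonneg_right huR (abs_nonneg u)
  rw [← hu] at hD
  constructor
  · rw [im_smul_SL, ← hu, div_le_iff₀ hD]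
    have h1 : 2 * (R * (|g 1 0| * z.im)) ≤ u ^ 2 + (g 1 0 * z.im) ^ 2 := by
      have h2 : (g 1 0 * z.im) ^ 2 = (|g 1 0| * z.im) ^ 2 := by
        rw [mul_pow, mul_pow, sq_abs]
      have h3 : R ^ 2 ≤ u ^ 2 := by nlinarith
      rw [h2]
      nlinarith [sq_nonneg (R - |g 1 0| * z.im)]
    have h4 := mul_le_mul_of_nonneg_left h1 hε.le
    have h5 := mul_le_mul_of_nonneg_left hRε hzi.le
    nlinarith
  · have e : (g • z).re - g 0 0 / g 1 0 =
        -(u / (g 1 0 * (u ^ 2 + (g 1 0 * z.im) ^ 2))) := by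
      rw [re_smul_SL, ← hu]
      have hD' := hD.ne'
      field_simp
      rw [hu]
      linear_combination (-(g 1 0 * z.re + g 1 1)) * det_eq_one_of_SL g
    have h1 : |(g • z).re - g 0 0 / g 1 0| ≤ 1 := by
      rw [e, abs_neg, abs_div, abs_mul, abs_of_pos hD, div_le_one (by positivity)]
      have h2 : |u| ≤ |g 1 0| * (R * |u|) := by
        have := mul_le_mul_of_nonneg_right hRc (abs_nonneg u)
        linarith
      refine h2.trans (mul_le_mul_of_nonneg_left ?_ hc0.le)
      nlinarith [sq_nonneg (g 1 0 * z.im)]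
    have h3 := abs_sub_le (g • z).re (g 0 0 / g 1 0) α
    linarith

end moebius

end UpperHalfPlane

/-! ### Ping-pong between a finite rotation group and a translation -/

namespace UpperHalfPlane

/-- The rotation by `-2θ` about `e^{iθ}`, for `α = cos θ`. -/
def pieceMatrix (α : ℝ) : SL(2, ℝ) := ⟨!![2 * α, -1; 1, 0], by simp [Matrix.det_fin_two]⟩

lemma pieceMatrix_smul (α : ℝ) (z : ℍ) : pieceMatrix α • z = reflLine α (reflUnit z) := by
  have h := z.absSq_pos
  have h10 : (pieceMatrix α) 1 0 = 1 := rfl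
  have h11 : (pieceMatrix α) 1 1 = 0 := rfl
  have h00 : (pieceMatrix α) 0 0 = 2 * α := rfl
  have h01 : (pieceMatrix α) 0 1 = -1 := rfl
  have hab : z.absSq = z.re ^ 2 + z.im ^ 2 := rfl
  apply ext_re_im
  · rw [re_smul_SL, h10, h11, h00, h01]
    simp only [one_mul, add_zero, reflLine_re, reflUnit_re]
    rw [← hab]
    field_simp
    rw [hab]
    ring
  · rw [im_smul_SL, h10, h11]
    simp only [one_mul, add_zero, reflLine_im, reflUnit_im]
    rw [← hab]

lemma zpow_smul_eq_emod {M : SL(2, ℝ)} {N : ℕ} (hM : ∀ z : ℍ, M ^ N • z = z) (j : ℤ) (z : ℍ) :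
    M ^ j • z = M ^ (j % N) • z := by
  have hk : ∀ k : ℤ, ∀ z : ℍ, (M ^ N) ^ k • z = z := fun k z => by
    have : M ^ N ∈ MulAction.stabilizer SL(2, ℝ) z := hM z
    exact Subgroup.zpow_mem _ this k
  conv_lhs => rw [← Int.emod_add_mul_ediv j N, zpow_add, mul_smul, zpow_mul, zpow_natCast, hk]

lemma zpow_smul_fixed {M : SL(2, ℝ)} {p : ℍ} (hp : M • p = p) (j : ℤ) : M ^ j • p = p :=
  (MulAction.stabilizer SL(2, ℝ) p).zpow_mem (show M ∈ _ from hp) j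

/-- The nontrivial powers of an elliptic transformation of finite order map the complement of
a wide strip to low points of the strip. -/
lemma exists_forall_zpow_low {M : SL(2, ℝ)} {N : ℕ} (hN : 0 < N) (hM : ∀ z : ℍ, M ^ N • z = z)
    {p : ℍ} (hp : M • p = p) (α : ℝ) {ε : ℝ} (hε : 0 < ε) :
    ∃ W, ∀ ω, W ≤ ω → ∀ j : ℤ, (∀ z : ℍ, M ^ j • z = z) ∨ ∀ z : ℍ, ω / 4 ≤ |z.re - α| →
      (M ^ j • z).im ≤ ε ∧ |(M ^ j • z).re - α| < ω / 4 := by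
  have hev : ∀ᶠ ω in Filter.atTop, ∀ i : Fin N, (∀ z : ℍ, M ^ ((i : ℕ) : ℤ) • z = z) ∨
      ∀ z : ℍ, ω / 4 ≤ |z.re - α| →
        (M ^ ((i : ℕ) : ℤ) • z).im ≤ ε ∧ |(M ^ ((i : ℕ) : ℤ) • z).re - α| < ω / 4 := by
    refine Filter.eventually_all.2 fun i => ?_
    by_cases hi : (M ^ ((i : ℕ) : ℤ) : SL(2, ℝ)) 1 0 = 0
    · exact Filter.Eventually.of_forall fun _ =>
        Or.inl (smul_eq_of_entry_eq_zero hi (zpow_smul_fixed hp _))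
    · exact (eventually_smul_low hi α hε).mono fun _ h => Or.inr h
  obtain ⟨W, hW⟩ := Filter.eventually_atTop.1 hev
  refine ⟨W, fun ω hω j => ?_⟩
  have hnn : 0 ≤ j % N := Int.emod_nonneg _ (by omega)
  have hlt : j % N < N := Int.emod_lt_of_pos _ (by omega)
  have := hW ω hω ⟨(j % N).toNat, by omega⟩
  simp only [Int.toNat_of_nonneg hnn] at this
  simpa only [zpow_smul_eq_emod hM j] using this

lemma exists_pieceMatrix_fixed {α θ : ℝ} (hs : 0 < Real.sin θ) (hα : α = Real.cos θ) :
    ∃ p : ℍ, p.re = α ∧ p.absSq = 1 ∧ pieceMatrix α • p = p := by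
  have hsc := Real.sin_sq_add_cos_sq θ
  have hpab : absSq ⟨⟨α, Real.sin θ⟩, hs⟩ = 1 := by
    simp only [absSq, mk_re, mk_im, hα]; linarith
  refine ⟨_, rfl, hpab, ?_⟩
  rw [pieceMatrix_smul, isMirror_reflUnit.fix _ (by simp [hpab]),
    (isMirror_reflLine _).fix _ (by simp)]

/-- The orbit of `y` under a free product of `⟨M⟩` and a group of translations, as a set of words
obeying a ping-pong condition. -/
inductive PingPongOrbit (M : SL(2, ℝ)) (ω : ℝ) (S : Set ℍ) (y : ℍ) : ℍ → Prop
  | base (j : ℤ) : PingPongOrbit M ω S y (M ^ j • y)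
  | step (j l : ℤ) {w : ℍ} : PingPongOrbit M ω S y w → w ∈ S → l ≠ 0 →
      PingPongOrbit M ω S y (M ^ j • ((l * ω : ℝ) +ᵥ w))

/-- Nonzero translates of the strip `S` leave it, and each nontrivial power of `M` sends the
complement of `S` to points of `S` of height at most `h`. So every orbit point of `y` is a power of
`M` applied to `y`, or lies outside `S`, or is low. Since `z₀` is neither low nor fixed by a
nontrivial power of `M`, all orbit points except `y` keep away from `z₀`. -/
lemma exists_injectivity_radius {M : SL(2, ℝ)} {N : ℕ} (hN : 0 < N)
    (hM : ∀ z : ℍ, M ^ N • z = z) {α ω h : ℝ} (hω : 0 < ω)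
    (hlow : ∀ j : ℤ, (∀ z : ℍ, M ^ j • z = z) ∨ ∀ z : ℍ, ω / 4 ≤ |z.re - α| →
      (M ^ j • z).im ≤ h ∧ |(M ^ j • z).re - α| < ω / 4)
    {z₀ : ℍ} (h1 : α - ω / 2 ≤ z₀.re) (h2 : z₀.re ≤ α) (him : h < z₀.im)
    (hfix : ∀ j : ℤ, M ^ j • z₀ = z₀ → ∀ z : ℍ, M ^ j • z = z) :
    ∃ δ > 0, ∀ y, dist y z₀ < δ → ∃ T : Set ℍ, y ∈ T ∧ (∀ j : ℤ, ∀ z ∈ T, M ^ j • z ∈ T) ∧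
      (∀ l : ℤ, ∀ z ∈ T, (l * ω : ℝ) +ᵥ z ∈ T) ∧
      ∀ x, dist x z₀ < δ → ∀ z ∈ T, dist x y ≤ dist x z := by
  set S : Set ℍ := {z | α - 3 * ω / 4 ≤ z.re ∧ z.re < α + ω / 4} with hS
  have hSc : ∀ z, z ∉ S → ω / 4 ≤ |z.re - α| := fun z hz => by
    simp only [hS, Set.mem_ofPred_eq, not_and_or, not_le, not_lt] at hz
    rw [le_abs]
    rcases hz with hz | hz
    · right; linarith
    · left; linarith
  have hSi : ∀ z : ℍ, |z.re - α| < ω / 4 → z ∈ S := fun z hz => by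
    have := abs_lt.1 hz
    exact ⟨by linarith, by linarith⟩
  have hV : {z : ℍ | |z.re - z₀.re| < ω / 4 ∧ h < z.im} ∈ 𝓝 z₀ := by
    have c1 : Continuous fun z : ℍ => |z.re - z₀.re| :=
      (UpperHalfPlane.continuous_re.sub continuous_const).abs
    exact ((isOpen_lt c1 continuous_const).inter
      (isOpen_lt continuous_const UpperHalfPlane.continuous_im)).mem_nhds
      ⟨by show |z₀.re - z₀.re| < ω / 4; rw [sub_self, abs_zero]; linarith, him⟩
  obtain ⟨η, hη, hball⟩ := Metric.mem_nhds_iff.1 hV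
  have hpow := fun j : ℤ => zpow_smul_eq_emod hM j
  obtain ⟨κ, hκ, hκ'⟩ : ∃ κ > 0, ∀ j : ℤ, M ^ j • z₀ ≠ z₀ → κ ≤ dist z₀ (M ^ j • z₀) := by
    have hfin : ∀ n : ℕ, ∃ κ > 0, ∀ i < n, M ^ (i : ℤ) • z₀ ≠ z₀ →
        κ ≤ dist z₀ (M ^ (i : ℤ) • z₀) := fun n => by
      induction n with
      | zero => exact ⟨1, one_pos, by simp⟩
      | succ n ih =>
        obtain ⟨κ, hκ, ih⟩ := ih
        by_cases hn : M ^ (n : ℤ) • z₀ = z₀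
        · refine ⟨κ, hκ, fun i hi hne => ?_⟩
          rcases (Nat.lt_succ_iff_lt_or_eq.1 hi) with hi | rfl
          · exact ih i hi hne
          · exact absurd hn hne
        · refine ⟨min κ (dist z₀ (M ^ (n : ℤ) • z₀)),
            lt_min hκ (dist_pos.2 (Ne.symm hn)), fun i hi hne => ?_⟩
          rcases (Nat.lt_succ_iff_lt_or_eq.1 hi) with hi | rfl
          · exact (min_le_left _ _).trans (ih i hi hne)
          · exact min_le_right _ _
    obtain ⟨κ, hκ, hk⟩ := hfin N
    refine ⟨κ, hκ, fun j hj => ?_⟩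
    have hnn : 0 ≤ j % N := Int.emod_nonneg _ (by omega)
    have hlt : j % N < N := Int.emod_lt_of_pos _ (by omega)
    have e : ((j % N).toNat : ℤ) = j % N := Int.toNat_of_nonneg hnn
    have := hk (j % N).toNat (by omega)
    rw [e, ← hpow] at this
    exact this hj
  -- Two points of the `δ`-ball are less than `2δ` apart, while the other orbit points are at
  -- distance at least `η - δ` or `κ - 2δ` from `x`.
  obtain ⟨δ, hδ, hδη, hδκ⟩ : ∃ δ > 0, 3 * δ ≤ η ∧ 4 * δ ≤ κ :=
    ⟨min (η / 3) (κ / 4), by positivity,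
      by linarith [min_le_left (η / 3) (κ / 4)], by linarith [min_le_right (η / 3) (κ / 4)]⟩
  refine ⟨δ, hδ, fun y hy => ?_⟩
  have hyV := hball (show y ∈ Metric.ball z₀ η by rw [Metric.mem_ball]; linarith)
  have hyS : y ∈ S := by
    have := abs_lt.1 hyV.1
    exact ⟨by linarith, by linarith⟩
  have hshift : ∀ (l : ℤ) (w : ℍ), w ∈ S → l ≠ 0 → ((l * ω : ℝ) +ᵥ w) ∉ S := by
    rintro l w ⟨hw1, hw2⟩ hl ⟨hw3, hw4⟩
    rw [vadd_re] at hw3 hw4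
    rcases lt_or_gt_of_ne hl with hl | hl
    · have : (l : ℝ) ≤ -1 := by exact_mod_cast (by omega : l ≤ -1)
      nlinarith
    · have : (1 : ℝ) ≤ l := by exact_mod_cast hl
      nlinarith
  have hinv : ∀ j : ℤ, (∀ z : ℍ, M ^ (-j) • z = z) → ∀ z : ℍ, M ^ j • z = z := fun j hj z => by
    have := hj (M ^ j • z)
    rw [zpow_neg, inv_smul_smul] at this
    exact this.symm
  have hzero : ∀ z : ℍ, PingPongOrbit M ω S y z → ∀ j : ℤ,
      PingPongOrbit M ω S y (M ^ j • z) := fun z hz j => by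
    cases hz with
    | base i => rw [← mul_smul, ← zpow_add]; exact .base _
    | step i l hw hwS hl => rw [← mul_smul, ← zpow_add]; exact .step _ l hw hwS hl
  refine ⟨{z | PingPongOrbit M ω S y z}, by simpa using PingPongOrbit.base (M := M) 0,
    fun j z hz => hzero z hz j, fun m z hz => ?_, fun x hx z hz => ?_⟩
  · have hstep : ∀ (k : ℤ) (w : ℍ), PingPongOrbit M ω S y w → w ∈ S →
        PingPongOrbit M ω S y ((k * ω : ℝ) +ᵥ w) := fun k w hw hwS => by
      by_cases hk : k = 0
      · simpa [hk] using hw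
      · simpa using PingPongOrbit.step 0 k hw hwS hk
    by_cases hzS : z ∈ S
    · exact hstep m z hz hzS
    · cases hz with
      | base j =>
        exfalso
        rcases hlow (-j) with ht | hl
        · rw [hinv j ht] at hzS; exact hzS hyS
        · have := (hl _ (hSc _ hzS)).1
          rw [zpow_neg, inv_smul_smul] at this
          exact absurd hyV.2 (not_lt.2 this)
      | @step j l w hw hwS hl =>
        rcases hlow j with ht | hl'
        · rw [ht, vadd_vadd]
          have := hstep (m + l) w hw hwS
          rw [show ((m + l : ℤ) * ω : ℝ) = m * ω + l * ω by push_cast; ring] at this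
          exact this
        · exact absurd (hSi _ (hl' _ (hSc _ (hshift l w hwS hl))).2) hzS
  · have hfar : z ∉ {z : ℍ | |z.re - z₀.re| < ω / 4 ∧ h < z.im} → dist x y ≤ dist x z := by
      intro hzV
      have h3 : η ≤ dist z z₀ := by
        by_contra! hc
        exact hzV (hball hc)
      have h4 := dist_triangle_right x y z₀
      have h5 := dist_triangle_left z z₀ x
      linarith
    cases hz with
    | base j =>
      by_cases hj : M ^ j • z₀ = z₀
      · rw [hfix j hj]
      · have h3 := hκ' j hj
        have h4 : dist (M ^ j • y) (M ^ j • z₀) = dist y z₀ := dist_smul _ _ _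
        have h5 := dist_triangle4 z₀ x (M ^ j • y) (M ^ j • z₀)
        have h6 := dist_triangle_right x y z₀
        rw [dist_comm z₀ x] at h5
        linarith
    | @step j l w hw hwS hl =>
      apply hfar
      have hwn := hshift l w hwS hl
      rcases hlow j with ht | hl'
      · rw [ht]
        rintro ⟨h3, -⟩
        have h4 := abs_lt.1 h3
        exact hwn ⟨by linarith, by linarith⟩
      · rintro ⟨-, h3⟩
        exact absurd h3 (not_lt.2 (hl' _ (hSc _ hwn)).1)

/-- A point of height at most `sin θ / 2` outside the unit disc with `Re z ≤ cos θ` has `Re z < -1 /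
2`. The truncating circle on the left gives `-β Re z ≤ 5 / 4`, which `β ≥ 4` excludes. -/
lemma half_sin_lt_im {θ : ℝ} (hs : 0 < Real.sin θ) (hc : 0 ≤ Real.cos θ) {α β : ℝ≥0}
    (hα : (α : ℝ) = Real.cos θ) (hβ : 4 ≤ (β : ℝ)) {z : ℍ} (hz : z ∈ halfPiece α β) :
    Real.sin θ / 2 < z.im := by
  obtain ⟨⟨h1, h2, h3⟩, -, h5⟩ := mem_halfPiece_iff.1 hz
  rw [hα] at h2
  have h := Real.sin_sq_add_cos_sq θ
  have hab : z.absSq = z.re ^ 2 + z.im ^ 2 := rfl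
  have hi := z.im_pos
  have hs1 := Real.sin_le_one θ
  by_contra! hle
  have hi2 : z.im ^ 2 ≤ Real.sin θ ^ 2 / 4 := by nlinarith
  have hi3 : z.im ^ 2 ≤ 1 / 4 := by nlinarith
  rcases le_total 0 z.re with h0 | h0
  · nlinarith
  · rcases le_total (-(1 / 2)) z.re with h6 | h6
    · nlinarith
    · have : (β + z.re) * z.re ≤ 0 := mul_nonpos_of_nonneg_of_nonpos (by linarith) h0
      nlinarith

end UpperHalfPlane

namespace IsPieceChart

lemma exists_hdist_radius {Tu Tv : SL(2, ℝ)} {α β : ℝ≥0} {φ : ℍ → ℍ}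
    (h : IsPieceChart Tu Tv α β φ) {θ : ℝ} (hs : 0 < Real.sin θ) (hc : 0 ≤ Real.cos θ)
    (hα : (α : ℝ) = Real.cos θ) (hβ : 4 ≤ (β : ℝ)) {N : ℕ} (hN : 0 < N)
    (hM : ∀ z : ℍ, pieceMatrix α ^ N • z = z)
    (hlow : ∀ j : ℤ, (∀ z : ℍ, pieceMatrix α ^ j • z = z) ∨ ∀ z : ℍ,
      2 * (α + β : ℝ) / 4 ≤ |z.re - α| → (pieceMatrix α ^ j • z).im ≤ Real.sin θ / 2 ∧
        |(pieceMatrix α ^ j • z).re - α| < 2 * (α + β : ℝ) / 4)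
    {p₀ : halfPiece α β} (hv : ¬ (p₀.1.re = α ∧ p₀.1.absSq = 1)) :
    ∃ δ > 0, ∀ x y z : ℍ, dist x p₀.1 < δ → dist y p₀.1 < δ →
      proj (pairGroup Tu Tv) (φ z) = proj (pairGroup Tu Tv) (φ y) → dist x y ≤ dist x z := by
  obtain ⟨p, hpre, hpab, hp⟩ := exists_pieceMatrix_fixed hs hα
  have hpj := zpow_smul_fixed hp
  have hpne : p₀.1 ≠ p := fun he => hv (by rw [he]; exact ⟨hpre, hpab⟩)
  obtain ⟨⟨b1, b2, -⟩, -, -⟩ := mem_halfPiece_iff.1 p₀.2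
  have hα0 := α.coe_nonneg
  obtain ⟨δ, hδ, hT⟩ := exists_injectivity_radius (M := pieceMatrix α) (α := α)
    (ω := 2 * (α + β : ℝ)) (h := Real.sin θ / 2) (z₀ := p₀.1) hN hM (by linarith)
    hlow (by linarith) b2 (half_sin_lt_im hs hc hα hβ p₀.2)
    (fun j hj => by
      by_cases hj' : (pieceMatrix α ^ j : SL(2, ℝ)) 1 0 = 0
      · exact smul_eq_of_entry_eq_zero hj' (hpj j)
      · exact absurd (eq_of_smul_eq_of_ne hj' hj (hpj j)) hpne)
  refine ⟨δ, hδ, fun x y z hx hy hz => ?_⟩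
  obtain ⟨T, hyT, hTM, hTP, hTd⟩ := hT y hy
  have hAi : ∀ w, w ∈ T ↔ reflLine α (reflUnit w) ∈ T := fun w => by
    rw [← pieceMatrix_smul]
    constructor
    · intro hw; simpa using hTM 1 w hw
    · intro hw; simpa using hTM (-1) _ hw
  -- The two reflections in vertical lines differ by the translation by `ω = 2(α + β)`, so the group
  -- is generated by the rotation and this translation.
  have hB : ∀ w, reflLine (-β) w = (((-1 : ℤ) : ℝ) * (2 * (α + β : ℝ))) +ᵥ reflLine α w :=
    fun w => by
      apply ext_re_im
      · rw [vadd_re, reflLine_re, reflLine_re]; push_cast; ring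
      · rw [vadd_im, reflLine_im, reflLine_im]
  refine hTd x hx z ((h.mem_iff_of_proj_eq hAi (fun w => ?_) hz).1 hyT)
  rw [hAi w, hB]
  constructor
  · intro hw; exact hTP (-1) _ hw
  · intro hw
    have := hTP 1 _ hw
    rw [vadd_vadd] at this
    simpa using this

end IsPieceChart

/-! ### Normalization of the two generators -/

lemma coe_unitParabolic_zpow (k : ℤ) :
    ((unitParabolic ^ k : SL(2, ℝ)) : Matrix (Fin 2) (Fin 2) ℝ) = !![1, (k : ℝ); 0, 1] := by
  have hinv : ((unitParabolic⁻¹ : SL(2, ℝ)) : Matrix (Fin 2) (Fin 2) ℝ) = !![1, -1; 0, 1] := by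
    rw [Matrix.SpecialLinearGroup.coe_inv]
    simp [unitParabolic, Matrix.adjugate_fin_two]
  induction k using Int.induction_on with
  | zero => simp [Matrix.one_fin_two]
  | succ n ih =>
    rw [zpow_add_one, Matrix.SpecialLinearGroup.coe_mul, ih]
    simp [unitParabolic, add_comm]
  | pred n ih =>
    rw [zpow_sub_one, Matrix.SpecialLinearGroup.coe_mul, ih, hinv]
    simp
    ring

lemma unitParabolic_zpow_smul (k : ℤ) (z : ℍ) : unitParabolic ^ k • z = (k : ℝ) +ᵥ z := by
  have h := coe_unitParabolic_zpow k
  apply ext_re_im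
  · rw [re_smul_SL, h, vadd_re]; simp [add_comm]
  · rw [im_smul_SL, h, vadd_im]; simp

/-- The isometry of `ℍ` which normalizes a Möbius transformation with lower row `(c, d)`. -/
noncomputable def pieceChart (e c d : ℝ) (hc : c ≠ 0) (w : ℍ) : ℍ :=
  ⟨⟨(e * w.re - d) / c, w.im / |c|⟩, div_pos w.im_pos (abs_pos.2 hc)⟩

/-- In the coordinate `w`, which is `e (c z + d)` up to conjugation, `Tu` becomes `w ↦ 2α - 1 / w`,
and translating `z` by `k` adds `e k c = -(2α + 2β)`. -/
lemma isPieceChart_pieceChart {Tu : SL(2, ℝ)} (hc : Tu 1 0 ≠ 0) {α β e : ℝ} (he : e ^ 2 = 1)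
    (hα : e * (Tu 0 0 + Tu 1 1) = 2 * α) {k : ℤ} (hk : e * (k * Tu 1 0) = -(2 * α + 2 * β)) :
    IsPieceChart Tu (unitParabolic ^ k * Tu) α β (pieceChart e (Tu 1 0) (Tu 1 1) hc) := by
  have hdet := det_eq_one_of_SL Tu
  have hu : ∀ w, Tu • pieceChart e (Tu 1 0) (Tu 1 1) hc w =
      pieceChart e (Tu 1 0) (Tu 1 1) hc (reflLine α (reflUnit w)) := fun w => by
    have hw := w.im_pos
    have hN := w.absSq_pos
    have hre : (pieceChart e (Tu 1 0) (Tu 1 1) hc w).re = (e * w.re - Tu 1 1) / Tu 1 0 := rfl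
    have him : (pieceChart e (Tu 1 0) (Tu 1 1) hc w).im = w.im / |Tu 1 0| := rfl
    have hden : (Tu 1 0 * ((e * w.re - Tu 1 1) / Tu 1 0) + Tu 1 1) ^ 2 +
        (Tu 1 0 * (w.im / |Tu 1 0|)) ^ 2 = w.absSq := by
      rw [mul_pow (Tu 1 0) (w.im / _), div_pow, sq_abs, mul_div_cancel₀ _ hc]
      field_simp
      rw [absSq]
      linear_combination w.re ^ 2 * he
    have ha : Tu 0 0 = 2 * α * e - Tu 1 1 := by
      linear_combination e * hα - (Tu 0 0 + Tu 1 1) * he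
    apply ext_re_im
    · rw [re_smul_SL, hre, him, hden, div_pow, sq_abs]
      show _ = (e * (2 * α - w.re / w.absSq) - Tu 1 1) / Tu 1 0
      field_simp
      have hab : w.absSq = w.re ^ 2 + w.im ^ 2 := rfl
      rw [hab]
      linear_combination (-(e * w.re)) * hdet + (w.re ^ 2 + w.im ^ 2) * ha +
        (Tu 0 0) * w.re ^ 2 * he
    · rw [im_smul_SL, hre, him, hden]
      show _ = w.im / w.absSq / |Tu 1 0|
      rw [div_right_comm]
  refine ⟨fun x y => ?_, fun z => ?_, hu, fun w => ?_⟩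
  · have hx := x.im_pos
    have hy := y.im_pos
    have hc' := abs_pos.2 hc
    apply dist_eq_dist_of_cosh
    rw [cosh_dist', cosh_dist']
    show (((e * x.re - Tu 1 1) / Tu 1 0 - (e * y.re - Tu 1 1) / Tu 1 0) ^ 2 +
      (x.im / |Tu 1 0|) ^ 2 + (y.im / |Tu 1 0|) ^ 2) /
      (2 * (x.im / |Tu 1 0|) * (y.im / |Tu 1 0|)) = _
    rw [← sub_div, div_pow, div_pow, div_pow, sq_abs,
      show 2 * (x.im / |Tu 1 0|) * (y.im / |Tu 1 0|) = 2 * x.im * y.im / |Tu 1 0| ^ 2 by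
        field_simp, sq_abs]
    field_simp
    linear_combination (x.re - y.re) ^ 2 * he
  · refine ⟨⟨⟨e * (Tu 1 0 * z.re + Tu 1 1), |Tu 1 0| * z.im⟩,
      mul_pos (abs_pos.2 hc) z.im_pos⟩, ext_re_im ?_ ?_⟩
    · show (e * (e * (Tu 1 0 * z.re + Tu 1 1)) - Tu 1 1) / Tu 1 0 = z.re
      rw [div_eq_iff hc]
      linear_combination (Tu 1 0 * z.re + Tu 1 1) * he
    · show |Tu 1 0| * z.im / |Tu 1 0| = z.im
      exact mul_div_cancel_left₀ _ (abs_ne_zero.2 hc)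
  · rw [mul_smul, hu, unitParabolic_zpow_smul]
    apply ext_re_im
    · rw [vadd_re]
      show (k : ℝ) + (e * (2 * α - w.re / w.absSq) - Tu 1 1) / Tu 1 0 =
        (e * (2 * -β - w.re / w.absSq) - Tu 1 1) / Tu 1 0
      rw [eq_div_iff hc, add_mul, div_mul_cancel₀ _ hc]
      linear_combination e * hk - (k * Tu 1 0) * he
    · rw [vadd_im]
      rfl

lemma exists_isPieceChart {Tu : SL(2, ℝ)} (hc : Tu 1 0 ≠ 0) {α : ℝ≥0}
    (hα : |Tu 0 0 + Tu 1 1| = 2 * α) (W : ℝ) :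
    ∃ (k : ℤ) (β : ℝ≥0) (φ : ℍ → ℍ), W ≤ β ∧ 1 ≤ (β : ℝ) ∧
      IsPieceChart Tu (unitParabolic ^ k * Tu) α β φ ∧
      |(unitParabolic ^ k * Tu) 0 0 + (unitParabolic ^ k * Tu) 1 1| = 2 * β ∧
      (Tu 0 0 + Tu 1 1) * ((unitParabolic ^ k * Tu) 0 0 + (unitParabolic ^ k * Tu) 1 1) ≤ 0 := by
  obtain ⟨e, he, hα'⟩ : ∃ e : ℝ, (e = 1 ∨ e = -1) ∧ e * (Tu 0 0 + Tu 1 1) = 2 * α := by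
    rcases abs_cases (Tu 0 0 + Tu 1 1) with ⟨h, -⟩ | ⟨h, -⟩
    · exact ⟨1, Or.inl rfl, by rw [one_mul, ← h, hα]⟩
    · exact ⟨-1, Or.inr rfl, by rw [neg_one_mul, ← h, hα]⟩
  have he2 : e ^ 2 = 1 := by rcases he with rfl | rfl <;> norm_num
  have he0 : e ≠ 0 := by rintro rfl; norm_num at he2
  -- `|k| = n`, with `n |c| = 2α + 2β`; the bound makes `β` exceed both `W` and `1`. The sign of `k`
  -- makes the trace of the new matrix `-2β e`, opposite to that of `Tu`.
  obtain ⟨n, hn⟩ := exists_nat_gt ((2 * α + 2 * max W 1) / |e * Tu 1 0|)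
  have hec : 0 < |e * Tu 1 0| := abs_pos.2 (mul_ne_zero he0 hc)
  rw [div_lt_iff₀ hec] at hn
  obtain ⟨k, hk⟩ : ∃ k : ℤ, e * (k * Tu 1 0) = -(n * |e * Tu 1 0|) := by
    rcases abs_cases (e * Tu 1 0) with ⟨h, -⟩ | ⟨h, -⟩
    · exact ⟨-n, by rw [h]; push_cast; ring⟩
    · exact ⟨n, by rw [h]; push_cast; ring⟩
  have hW := le_max_left W 1
  have h1 := le_max_right W 1
  obtain ⟨β, hβ⟩ : ∃ β : ℝ≥0, (β : ℝ) = (n * |e * Tu 1 0| - 2 * α) / 2 :=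
    ⟨⟨_, by linarith⟩, rfl⟩
  have hk' : e * (k * Tu 1 0) = -(2 * α + 2 * β) := by rw [hk, hβ]; ring
  have h00 : (unitParabolic ^ k * Tu) 0 0 = Tu 0 0 + k * Tu 1 0 := by
    rw [Matrix.SpecialLinearGroup.coe_mul, coe_unitParabolic_zpow]
    simp [Matrix.mul_apply, Fin.sum_univ_two]
  have h11 : (unitParabolic ^ k * Tu) 1 1 = Tu 1 1 := by
    rw [Matrix.SpecialLinearGroup.coe_mul, coe_unitParabolic_zpow]
    simp [Matrix.mul_apply, Fin.sum_univ_two]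
  have ht : Tu 0 0 + k * Tu 1 0 + Tu 1 1 = e * (-(2 * β)) := by
    linear_combination e * hk' + e * hα' - (Tu 0 0 + Tu 1 1 + k * Tu 1 0) * he2
  refine ⟨k, β, _, by linarith, by linarith, isPieceChart_pieceChart hc he2 hα' hk', ?_, ?_⟩
  · rw [h00, h11, ht]
    rcases he with rfl | rfl <;> simp
  · rw [h00, h11, ht]
    have : (Tu 0 0 + Tu 1 1) * (e * -(2 * β)) = -(4 * (α * β) : ℝ) := by
      linear_combination (-2 * β : ℝ) * hα'
    rw [this]
    have : (0 : ℝ) ≤ α * β := by positivity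
    linarith

/-! ### Assembly of the two cases -/

namespace IsPieceChart

variable {Tu Tv : SL(2, ℝ)} {α β : ℝ≥0} {φ : ℍ → ℍ}

lemma containsYPiece (h : IsPieceChart Tu Tv α β φ) {u v : ℝ} (hu : (α : ℝ) = Real.cosh (u / 2))
    (hv : (β : ℝ) = Real.cosh (v / 2)) : ContainsYPiece (pairGroup Tu Tv) u v := by
  obtain rfl : α = (Real.cosh (u / 2)).toNNReal := by rw [← hu, Real.toNNReal_coe]
  obtain rfl : β = (Real.cosh (v / 2)).toNNReal := by rw [← hv, Real.toNNReal_coe]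
  obtain ⟨f, hL, hR⟩ := h.exists_pieceMap
  have hC := isChamber_of_one_le (hu.symm ▸ Real.one_le_cosh (u / 2))
    (hv.symm ▸ Real.one_le_cosh (v / 2))
  have hf : ∀ a b, hdist (f a) (f b) = dist a b := fun a b =>
    le_antisymm (h.hdist_pieceMap_le hL hR a b) (h.dist_le_hdist_pieceMap hC hL hR a b)
  exact ⟨f, isEmbedding_of_hdist_eq hf, fun y =>
    ⟨Set.univ, Filter.univ_mem, fun a _ b _ => hf a b⟩⟩

lemma containsConeYPiece (h : IsPieceChart Tu Tv α β φ) {θ v : ℝ}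
    (hθ : (α : ℝ) = Real.cos θ) (hv : (β : ℝ) = Real.cosh (v / 2))
    (hC : (∃ n : ℕ, 2 ≤ n ∧ θ = Real.pi / n) ∨ ¬ (∃ n : ℕ, 2 ≤ n ∧ θ = Real.pi / n) ∧
      ∀ p : halfPiece α β, ¬ (p.1.re = α ∧ p.1.absSq = 1) → ∃ δ > 0, ∀ x y z : ℍ,
        dist x p.1 < δ → dist y p.1 < δ →
        proj (pairGroup Tu Tv) (φ z) = proj (pairGroup Tu Tv) (φ y) → dist x y ≤ dist x z) :
    ContainsConeYPiece (pairGroup Tu Tv) Tu θ v := by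
  obtain rfl : α = (Real.cos θ).toNNReal := by rw [← hθ, Real.toNNReal_coe]
  obtain rfl : β = (Real.cosh (v / 2)).toNNReal := by rw [← hv, Real.toNNReal_coe]
  obtain ⟨f, hL, hR⟩ := h.exists_pieceMap
  have hle := h.hdist_pieceMap_le hL hR
  have hβ : (1 : ℝ) ≤ (Real.cosh (v / 2)).toNNReal := hv.symm ▸ Real.one_le_cosh (v / 2)
  refine ⟨f, continuous_of_hdist_le hle, ?_, ?_⟩
  · rintro y ⟨p, hp1, hp2, rfl⟩
    refine ⟨φ p.1, ?_, hL p⟩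
    rw [h.smul_u, isMirror_reflUnit.fix _ (by simp [absSq, hp2]),
      (isMirror_reflLine _).fix _ (by simp [hp1])]
  · rcases hC with ⟨n, hn, hn'⟩ | ⟨hn, hC⟩
    · have hch := isChamber_of_pi_div hn hn' hβ
      rw [← hθ] at hch
      have hf : ∀ a b, hdist (f a) (f b) = dist a b := fun a b =>
        le_antisymm (hle a b) (h.dist_le_hdist_pieceMap hch hL hR a b)
      have hloc : ∀ y, IsLocallyIsometricAt f y := fun y =>
        ⟨Set.univ, Filter.univ_mem, fun a _ b _ => hf a b⟩
      exact ⟨fun y _ => hloc y, fun _ => ⟨isEmbedding_of_hdist_eq hf, hloc⟩⟩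
    · refine ⟨fun y hy => ?_, fun hn' => absurd hn' hn⟩
      obtain ⟨p, hp⟩ : ∃ p, y = inL p ∨ y = inR p := by
        rcases exists_rep y with ⟨p, hp⟩ | ⟨p, hp⟩
        · exact ⟨p, Or.inl hp⟩
        · exact ⟨p, Or.inr hp⟩
      have hvert : ¬ (p.1.re = (Real.cos θ).toNNReal ∧ p.1.absSq = 1) := fun ⟨h1, h2⟩ => by
        refine hy ⟨p, h1, h2, ?_⟩
        rcases hp with hp | hp
        · exact hp
        · rw [hp]; exact (inL_eq_inR ⟨p, Or.inl h1⟩).symm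
      obtain ⟨δ, hδ, hinj⟩ := hC p hvert
      exact h.isLocallyIsometricAt (by exact_mod_cast hβ) hL hR hvert hδ hinj hp

lemma pieceMatrix_pow_smul (h : IsPieceChart Tu Tv α β φ) {N : ℕ}
    (hN : ∀ z : ℍ, Tu ^ N • z = z) (z : ℍ) : pieceMatrix α ^ N • z = z := by
  have key : ∀ n : ℕ, ∀ w, Tu ^ n • φ w = φ (pieceMatrix α ^ n • w) := fun n => by
    induction n with
    | zero => simp
    | succ n ih =>
      intro w
      rw [pow_succ, pow_succ, mul_smul, mul_smul, h.smul_u, ih, pieceMatrix_smul]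
  have h1 := key N z
  rw [hN] at h1
  have h2 := h.isom z (pieceMatrix α ^ N • z)
  rw [← h1, dist_self] at h2
  exact (dist_eq_zero.1 h2.symm).symm

end IsPieceChart

theorem corollary3p4 (Γ : Subgroup PSL(2, ℝ)) (hΓ : IsFuchsian Γ)
    (hT : toPSL unitParabolic ∈ Γ) (Tu : SL(2, ℝ)) (hTu : toPSL Tu ∈ Γ) (hc : Tu 1 0 ≠ 0) :
    ∃ (k : ℤ) (Tv : SL(2, ℝ)) (v : ℝ),
      Tv = unitParabolic ^ k * Tu ∧ toPSL Tv ∈ Γ ∧ 0 ≤ v ∧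
      |Tv 0 0 + Tv 1 1| = 2 * Real.cosh (v / 2) ∧
      (Tu 0 0 + Tu 1 1) * (Tv 0 0 + Tv 1 1) ≤ 0 ∧
      (2 ≤ |Tu 0 0 + Tu 1 1| → ∃ u : ℝ, 0 ≤ u ∧ 2 * Real.cosh (u / 2) = |Tu 0 0 + Tu 1 1| ∧
        ContainsYPiece (Subgroup.closure {toPSL Tu, toPSL Tv}) u v) ∧
      (|Tu 0 0 + Tu 1 1| < 2 → ∃ θ : ℝ, 0 < θ ∧ θ ≤ Real.pi / 2 ∧
        2 * Real.cos θ = |Tu 0 0 + Tu 1 1| ∧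
        ContainsConeYPiece (Subgroup.closure {toPSL Tu, toPSL Tv}) Tu θ v) := by
  have hmem : ∀ k : ℤ, toPSL (unitParabolic ^ k * Tu) ∈ Γ := fun k =>
    (liftSL Γ).mul_mem ((liftSL Γ).zpow_mem hT k) hTu
  obtain ⟨α, hα⟩ : ∃ α : ℝ≥0, |Tu 0 0 + Tu 1 1| = 2 * α :=
    ⟨⟨|Tu 0 0 + Tu 1 1| / 2, by positivity⟩, (mul_div_cancel₀ _ two_ne_zero).symm⟩
  have hlen : ∀ x : ℝ, 1 ≤ x → 0 ≤ 2 * Real.arcosh x ∧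
      Real.cosh (2 * Real.arcosh x / 2) = x := fun x hx =>
    ⟨mul_nonneg zero_le_two (Real.arcosh_nonneg hx), by
      rw [mul_div_cancel_left₀ _ two_ne_zero, Real.cosh_arcosh hx]⟩
  rcases le_or_gt 2 |Tu 0 0 + Tu 1 1| with ht | ht
  · obtain ⟨k, β, φ, -, hβ, h, hβt, hs⟩ := exists_isPieceChart hc hα 0
    obtain ⟨hv0, hv⟩ := hlen β hβ
    obtain ⟨hu0, hu⟩ := hlen α (by linarith)
    refine ⟨k, _, _, rfl, hmem k, hv0, by rw [hβt, hv], hs, fun _ =>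
      ⟨_, hu0, by rw [hu, hα], h.containsYPiece hu.symm hv.symm⟩, fun h' => ?_⟩
    exact absurd h' (not_lt.2 ht)
  · have hα1 : (α : ℝ) < 1 := by linarith
    have hα0 := α.coe_nonneg
    obtain ⟨θ, hθ⟩ : ∃ θ, θ = Real.arccos α := ⟨_, rfl⟩
    have hcos : (α : ℝ) = Real.cos θ := by rw [hθ, Real.cos_arccos (by linarith) hα1.le]
    have hθ0 : 0 < θ := by rw [hθ]; exact Real.arccos_pos.2 hα1
    have hθ1 : θ ≤ Real.pi / 2 := by rw [hθ]; exact Real.arccos_le_pi_div_two.2 hα0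
    have hsin : 0 < Real.sin θ :=
      Real.sin_pos_of_pos_of_lt_pi hθ0 (by linarith [Real.pi_pos])
    obtain ⟨N, hN0, hN⟩ := hΓ.exists_pow_smul_eq hTu ht
    -- The normalized rotation depends only on `α`, so its order can be read off from any chart. The
    -- threshold `W` for `β` is thus available before the final `k` is chosen.
    have hM : ∀ z : ℍ, pieceMatrix α ^ N • z = z := by
      obtain ⟨k, β, φ, -, -, h, -⟩ := exists_isPieceChart hc hα 0
      exact h.pieceMatrix_pow_smul hN
    obtain ⟨p, -, -, hp⟩ := exists_pieceMatrix_fixed hsin hcos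
    obtain ⟨W, hW⟩ := exists_forall_zpow_low hN0 hM hp α (half_pos hsin)
    obtain ⟨k, β, φ, hWβ, hβ, h, hβt, hs⟩ := exists_isPieceChart hc hα (max |W| 4)
    have hWω : W ≤ 2 * (α + β : ℝ) := by
      linarith [le_abs_self W, abs_nonneg W, (le_max_left |W| 4).trans hWβ]
    obtain ⟨hv0, hv⟩ := hlen β hβ
    refine ⟨k, _, _, rfl, hmem k, hv0, by rw [hβt, hv], hs, fun h' => absurd h' (not_le.2 ht),
      fun _ => ⟨θ, hθ0, hθ1, by rw [hα, hcos], h.containsConeYPiece hcos hv.symm ?_⟩⟩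
    by_cases hn : ∃ n : ℕ, 2 ≤ n ∧ θ = Real.pi / n
    · exact Or.inl hn
    · exact Or.inr ⟨hn, fun p hp => h.exists_hdist_radius hsin (hcos ▸ hα0) hcos
        ((le_max_right _ _).trans hWβ) hN0 hM (hW _ hWω) hp⟩
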